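/- Let $\mathbb R_+=(0,\infty)$. Let $(\lambda_n)_{n\ge1}$ be a real sequence with $\lambda_1>0$ and $\lambda_n\ge0$ for all $n$, put $\Lambda_n:=\lambda_1+\dots+\lambda_n$, and assume that $\Lambda_n\to\infty$ and that $(\lambda_n/\Lambda_n)_{n\ge1}$ is nonincreasing with limit $\eta\in[0,1)$. Let $f:\mathbb R_+\to\mathbb R$ be concave with $\operatorname{sign}(f(x))=\operatorname{sign}(x-1)$ for all $x\in\mathbb R_+$. For $x_1,\dots,x_n\in\mathbb R_+$ and weights $w_1,\dots,w_n\ge0$ with $w_1+\dots+w_n>0$, let $\mathscr E_f\big((x_1,\dots,x_n),(w_1,\dots,w_n)\big)$ be the unique $y\in\mathbb R_+$ with $\sum_{i=1}^n w_i f(x_i/y)=0$ (the homogeneous quasideviation mean generated by $f$). Let $\mathscr H_\lambda(\mathscr E_f)$ be the smallest extended real number $C$ such that $$\sum_{n=1}^\infty \lambda_n\,\mathscr E_f\big((x_1,\dots,x_n),(\lambda_1,\dots,\lambda_n)\big)\le C\sum_{n=1}^\infty\lambda_n x_n\qquad\text{for all sequences }(x_n)\text{ in }\mathbb R_+,$$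 and call $\mathscr E_f$ a $\lambda$-Hardy mean if $\mathscr H_\lambda(\mathscr E_f)<\infty$. Then $\mathscr E_f$ is a $\lambda$-Hardy mean if and only if the function $x\mapsto f(1/x)$ is integrable over $(0,1]$. In that case, $c:=\mathscr H_\lambda(\mathscr E_f)$ is the unique solution $c\in(0,\infty)$ of the equation $$\int_0^1 f\Big(\frac1{cx}\Big)\,dx=0\quad\text{if }\eta=0,\qquad\qquad \sum_{k=0}^\infty(1-\eta)^k f\Big(\frac1{c(1-\eta)^k}\Big)=0\quad\text{if }\eta>0.$$ -/

import Mathlib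

open Set Filter Topology MeasureTheory

/-- A rule that assigns a real number to a vector `x` and a weight vector `w` of the same length `n`,
for every `n`. -/
abbrev WeightedMeanFun : Type := (n : ℕ) → (Fin n → ℝ) → (Fin n → ℝ) → ℝ

/-- `W_n`: nonnegative weight vectors of length `n` with positive sum. -/
def weightVectors (n : ℕ) : Set (Fin n → ℝ) :=
  {w | (∀ i, 0 ≤ w i) ∧ 0 < ∑ i, w i}

/-- `W_0`: nonnegative weight sequences with positive first element (sequences are indexed from `0`). -/
def weightSequences : Set (ℕ → ℝ) :=
  {lam | 0 < lam 0 ∧ ∀ n, 0 ≤ lam n}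

/-- The partial sum of the first `n + 1` weights; with indices starting at `0`, this is `Λ_{n+1}` in the
numbering that starts at `1`. -/
def weightSum (lam : ℕ → ℝ) (n : ℕ) : ℝ := ∑ i ∈ Finset.range (n + 1), lam i

/-- A quasideviation on `I`. -/
structure IsQuasideviation (I : Set ℝ) (E : ℝ → ℝ → ℝ) : Prop where
  sign_eq : ∀ x ∈ I, ∀ y ∈ I, SignType.sign (E x y) = SignType.sign (x - y)
  continuousOn : ∀ x ∈ I, ContinuousOn (fun y => E x y) I
  strictMonoOn : ∀ x ∈ I, ∀ y ∈ I, x < y → StrictMonoOn (fun t => E y t / E x t) (Ioo x y)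

open Classical in
/-- The `E`-quasideviation mean on `I`: the solution `y ∈ I` of
`w₁ E(x₁, y) + ⋯ + wₙ E(xₙ, y) = 0` (and `0` when there is no solution). -/
noncomputable def quasideviationMean (I : Set ℝ) (E : ℝ → ℝ → ℝ) : WeightedMeanFun :=
  fun _ x w =>
    if h : ∃ y ∈ I, ∑ i, w i * E (x i) y = 0 then h.choose else 0

/-- The mean `𝓔_f` on `(0, ∞)`: the quasideviation mean of `E(x, y) = f (x / y)`. -/
noncomputable def homQuasideviationMean (f : ℝ → ℝ) : WeightedMeanFun :=
  quasideviationMean (Ioi 0) (fun x y => f (x / y))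

/-- `C` is a constant in the `lam`-weighted Hardy inequality for the mean `M` on `I ⊆ (0, ∞)`. Both series have
nonnegative terms and are summed in `[0, ∞]`. -/
def IsHardyBound (I : Set ℝ) (M : WeightedMeanFun) (lam : ℕ → ℝ) (C : ENNReal) : Prop :=
  ∀ x : ℕ → ℝ, (∀ n, x n ∈ I) →
    ∑' n : ℕ, ENNReal.ofReal
        (lam n * M (n + 1) (fun i : Fin (n + 1) => x i) (fun i : Fin (n + 1) => lam i))
      ≤ C * ∑' n : ℕ, ENNReal.ofReal (lam n * x n)

/-- The `lam`-Hardy constant of `M`: the smallest extended real constant in the Hardy inequality. -/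
noncomputable def hardyConstant (I : Set ℝ) (M : WeightedMeanFun) (lam : ℕ → ℝ) : ENNReal :=
  sInf {C : ENNReal | IsHardyBound I M lam C}

/-- `M` is a `lam`-Hardy mean. -/
def IsHardyMean (I : Set ℝ) (M : WeightedMeanFun) (lam : ℕ → ℝ) : Prop :=
  hardyConstant I M lam < ⊤

/-- The positive number `c` solves `∫₀¹ f(1/(cx)) dx = 0` if `η = 0`, respectively
`∑ (1-η)^k f(1/(c(1-η)^k)) = 0` if `η ≠ 0`. -/
def SolvesHardyEquation (η : ℝ) (f : ℝ → ℝ) (c : ℝ) : Prop :=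
  0 < c ∧
  (η = 0 → IntegrableOn (fun x => f (1 / (c * x))) (Ioc 0 1) volume ∧
    ∫ x in Ioc (0 : ℝ) 1, f (1 / (c * x)) = 0) ∧
  (η ≠ 0 → HasSum (fun k : ℕ => (1 - η) ^ k * f (1 / (c * (1 - η) ^ k))) 0)

/-! Well-definedness: `f (x / y)` is a quasideviation, the equation that defines the mean has exactly one
solution, and the Hardy constant of the mean is attained. -/

section WellDefined

theorem sign_facts {f : ℝ → ℝ}
    (hs : ∀ x, 0 < x → SignType.sign (f x) = SignType.sign (x - 1)) :
    f 1 = 0 ∧ (∀ x, 0 < x → x < 1 → f x < 0) ∧ (∀ x, 1 < x → 0 < f x) := by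
  refine ⟨?_, fun x h0 h1 => ?_, fun x h1 => ?_⟩
  · have := hs 1 one_pos
    simpa using this
  · have h := hs x h0
    rw [sign_neg (by linarith : x - 1 < 0)] at h
    exact sign_eq_neg_one_iff.1 h
  · have h := hs x (by linarith)
    rw [sign_pos (by linarith : 0 < x - 1)] at h
    exact sign_eq_one_iff.1 h

theorem concave_sign_mono {f : ℝ → ℝ} (hf : ConcaveOn ℝ (Ioi 0) f)
    (hs : ∀ x, 0 < x → SignType.sign (f x) = SignType.sign (x - 1))
    {x y : ℝ} (hx : 0 < x) (hxy : x ≤ y) : f x ≤ f y := by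
  obtain ⟨-, -, hp⟩ := sign_facts hs
  rcases hxy.eq_or_lt with rfl | hxy
  · exact le_rfl
  by_contra! hlt
  set s := (f x - f y) / (y - x) with hsdef
  have hspos : 0 < s := div_pos (by linarith) (by linarith)
  set z := y + 1 + |f y| / s with hz
  have hq : 0 ≤ |f y| / s := by positivity
  have h1 := hf.slope_anti_adjacent (mem_Ioi.2 hx) (mem_Ioi.2 (by linarith : 0 < z)) hxy
    (by linarith : y < z)
  have h2 : (f y - f x) / (y - x) = -s := by rw [hsdef, ← neg_div]; congr 1; ring
  rw [h2, div_le_iff₀ (by linarith)] at h1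
  have h3 : s * (z - y) = s + |f y| := by
    rw [hz]; field_simp; ring
  have h4 : f y ≤ |f y| := le_abs_self _
  have h5 := hp z (by linarith)
  linarith

theorem concave_sign_strictMono {f : ℝ → ℝ} (hf : ConcaveOn ℝ (Ioi 0) f)
    (hs : ∀ x, 0 < x → SignType.sign (f x) = SignType.sign (x - 1))
    {x y : ℝ} (hx : 0 < x) (hxy : x < y) (hx1 : x < 1) : f x < f y := by
  obtain ⟨h1, hn, hp⟩ := sign_facts hs
  rcases lt_trichotomy y 1 with hy | rfl | hy
  · have h := hf.slope_anti_adjacent (mem_Ioi.2 hx) (mem_Ioi.2 one_pos) hxy hy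
    rw [h1] at h
    have hy0 := hn y (by linarith) hy
    have h6 : 0 < (0 - f y) / (1 - y) := div_pos (by linarith) (by linarith)
    have h7 : 0 < (f y - f x) / (y - x) := h6.trans_le h
    rw [div_pos_iff_of_pos_right (by linarith)] at h7
    linarith
  · rw [h1]; exact hn x hx hx1
  · exact (hn x hx hx1).trans (hp y hy)

theorem continuousOn_comp_div {f : ℝ → ℝ} (hf : ConcaveOn ℝ (Ioi 0) f) {x : ℝ} (hx : 0 < x) :
    ContinuousOn (fun y => f (x / y)) (Ioi 0) := by
  refine (hf.continuousOn isOpen_Ioi).comp ?_ (fun y hy => mem_Ioi.2 (div_pos hx hy))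
  exact continuousOn_const.div continuousOn_id (fun y hy => (mem_Ioi.1 hy).ne')

theorem isQuasideviation_div {f : ℝ → ℝ} (hf : ConcaveOn ℝ (Ioi 0) f)
    (hs : ∀ x, 0 < x → SignType.sign (f x) = SignType.sign (x - 1)) :
    IsQuasideviation (Ioi 0) (fun x y => f (x / y)) := by
  obtain ⟨h1, hn, hp⟩ := sign_facts hs
  refine ⟨fun x hx y hy => ?_, fun x hx => continuousOn_comp_div hf hx, ?_⟩
  · have hx' : 0 < x := hx
    have hy' : 0 < y := hy
    rcases lt_trichotomy x y with h | rfl | h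
    · rw [sign_neg (hn _ (div_pos hx' hy') ((div_lt_one hy').2 h)), sign_neg (by linarith)]
    · simp [div_self hx'.ne', h1]
    · rw [sign_pos (hp _ ((one_lt_div hy').2 h)), sign_pos (by linarith)]
  · intro x hx y hy hxy s hst t htt hlt
    have hx' : 0 < x := hx
    obtain ⟨hs1, hs2⟩ := hst
    obtain ⟨ht1, ht2⟩ := htt
    have hs0 : 0 < s := by linarith
    have ht0 : 0 < t := by linarith
    have hy0 : 0 < y := by linarith
    have a1 : 0 < f (y / t) := hp _ ((one_lt_div ht0).2 ht2)
    have a2 : f (y / t) ≤ f (y / s) :=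
      concave_sign_mono hf hs (div_pos hy0 ht0) (div_le_div_of_nonneg_left hy0.le hs0 hlt.le)
    have b1 : f (x / s) < 0 := hn _ (div_pos hx' hs0) ((div_lt_one hs0).2 hs1)
    have b2 : f (x / t) < f (x / s) :=
      concave_sign_strictMono hf hs (div_pos hx' ht0) (div_lt_div_of_pos_left hx' hs0 hlt)
        ((div_lt_one ht0).2 ht1)
    have b3 : f (x / t) < 0 := b2.trans b1
    change f (y / s) / f (x / s) < f (y / t) / f (x / t)
    rw [← neg_div_neg_eq (f (y / s)), ← neg_div_neg_eq (f (y / t)),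
      div_lt_div_iff₀ (by linarith) (by linarith)]
    nlinarith

theorem existsUnique_quasideviationMean {f : ℝ → ℝ} (hf : ConcaveOn ℝ (Ioi 0) f)
    (hs : ∀ x, 0 < x → SignType.sign (f x) = SignType.sign (x - 1))
    {n : ℕ} {x w : Fin n → ℝ} (hx : ∀ i, 0 < x i) (hw : w ∈ weightVectors n) :
    ∃! y, y ∈ Ioi (0 : ℝ) ∧ ∑ i, w i * f (x i / y) = 0 := by
  obtain ⟨h1, hn, hp⟩ := sign_facts hs
  obtain ⟨hw0, hwpos⟩ := hw
  have hne : (Finset.univ : Finset (Fin n)).Nonempty := by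
    by_contra h
    rw [Finset.not_nonempty_iff_eq_empty] at h
    rw [h] at hwpos
    simp at hwpos
  obtain ⟨a, -, ha⟩ := Finset.exists_min_image Finset.univ x hne
  obtain ⟨b, -, hb⟩ := Finset.exists_max_image Finset.univ x hne
  have hcont : ContinuousOn (fun y => ∑ i, w i * f (x i / y)) (Ioi 0) :=
    continuousOn_finsetSum _ fun i _ => continuousOn_const.mul (continuousOn_comp_div hf (hx i))
  have hsub : Icc (x a) (x b) ⊆ Ioi 0 := fun y hy => (hx a).trans_le hy.1
  have hb0 : ∑ i, w i * f (x i / x b) ≤ 0 := by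
    refine Finset.sum_nonpos fun i _ => mul_nonpos_of_nonneg_of_nonpos (hw0 i) ?_
    rw [← h1]
    exact concave_sign_mono hf hs (div_pos (hx i) (hx b))
      ((div_le_one (hx b)).2 (hb i (Finset.mem_univ i)))
  have ha0 : 0 ≤ ∑ i, w i * f (x i / x a) := by
    refine Finset.sum_nonneg fun i _ => mul_nonneg (hw0 i) ?_
    rw [← h1]
    exact concave_sign_mono hf hs one_pos
      ((one_le_div (hx a)).2 (ha i (Finset.mem_univ i)))
  obtain ⟨y, hy, hy0⟩ :=
    intermediate_value_Icc' (ha b (Finset.mem_univ b)) (hcont.mono hsub) ⟨hb0, ha0⟩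
  have key : ∀ u v : ℝ, 0 < u → u < v → ∑ i, w i * f (x i / u) = 0 →
      ∑ i, w i * f (x i / v) = 0 → False := by
    intro u v hu huv h0u h0v
    have hv : 0 < v := hu.trans huv
    have hle : ∀ i ∈ Finset.univ, w i * f (x i / v) ≤ w i * f (x i / u) := fun i _ =>
      mul_le_mul_of_nonneg_left (concave_sign_mono hf hs (div_pos (hx i) hv)
        (div_le_div_of_nonneg_left (hx i).le hu huv.le)) (hw0 i)
    have heq := (Finset.sum_eq_sum_iff_of_le hle).1 (h0v.trans h0u.symm)
    have hpos : ∀ i, 0 < w i → 0 < f (x i / u) := by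
      intro i hi
      have h3 : f (x i / v) = f (x i / u) := mul_left_cancel₀ hi.ne' (heq i (Finset.mem_univ i))
      have h4 : v ≤ x i := by
        by_contra! h
        exact (concave_sign_strictMono hf hs (div_pos (hx i) hv)
          (div_lt_div_of_pos_left (hx i) hu huv) ((div_lt_one hv).2 h)).ne h3
      exact hp _ ((one_lt_div hu).2 (by linarith))
    have hall : ∀ i ∈ Finset.univ, 0 ≤ w i * f (x i / u) := fun i _ => by
      rcases (hw0 i).eq_or_lt with h | h
      · simp [← h]
      · exact (mul_pos h (hpos i h)).le
    have hz := (Finset.sum_eq_zero_iff_of_nonneg hall).1 h0u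
    have hwz : ∀ i, w i = 0 := fun i => by
      by_contra h
      have hi : 0 < w i := lt_of_le_of_ne (hw0 i) (Ne.symm h)
      exact (mul_pos hi (hpos i hi)).ne' (hz i (Finset.mem_univ i))
    simp [hwz] at hwpos
  refine ⟨y, ⟨hsub hy, hy0⟩, fun z hz => ?_⟩
  rcases lt_trichotomy z y with h | h | h
  · exact (key z y hz.1 h hz.2 hy0).elim
  · exact h
  · exact (key y z (hsub hy) h hy0 hz.2).elim

/-- The mean `𝓔_f` is the solution of its defining equation, in `(0, ∞)`. -/
theorem homQuasideviationMean_spec {f : ℝ → ℝ} (hf : ConcaveOn ℝ (Ioi 0) f)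
    (hs : ∀ x, 0 < x → SignType.sign (f x) = SignType.sign (x - 1))
    {n : ℕ} {x w : Fin n → ℝ} (hx : ∀ i, 0 < x i) (hw : w ∈ weightVectors n) :
    0 < homQuasideviationMean f n x w ∧
      ∑ i, w i * f (x i / homQuasideviationMean f n x w) = 0 := by
  have h : ∃ y ∈ Ioi (0 : ℝ), ∑ i, w i * (fun x y => f (x / y)) (x i) y = 0 :=
    (existsUnique_quasideviationMean hf hs hx hw).exists
  have h2 : homQuasideviationMean f n x w = h.choose := dif_pos h
  rw [h2]
  exact h.choose_spec

/-- The Hardy constant of `𝓔_f` is itself a constant in the Hardy inequality, so it is the smallest one. -/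
theorem isLeast_hardyConstant {f : ℝ → ℝ} (hf : ConcaveOn ℝ (Ioi 0) f)
    (hs : ∀ x, 0 < x → SignType.sign (f x) = SignType.sign (x - 1))
    {lam : ℕ → ℝ} (hlam : lam ∈ weightSequences) :
    IsLeast {C : ENNReal | IsHardyBound (Ioi 0) (homQuasideviationMean f) lam C}
      (hardyConstant (Ioi 0) (homQuasideviationMean f) lam) := by
  obtain ⟨hl0, hl⟩ := hlam
  refine ⟨fun x hx => ?_, fun C hC => sInf_le hC⟩
  have hS0 : ∑' n : ℕ, ENNReal.ofReal (lam n * x n) ≠ 0 := by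
    intro h
    have h0 := ENNReal.tsum_eq_zero.1 h 0
    rw [ENNReal.ofReal_eq_zero] at h0
    exact (mul_pos hl0 (hx 0)).not_ge h0
  by_cases hS : ∑' n : ℕ, ENNReal.ofReal (lam n * x n) = ⊤
  · have hK : hardyConstant (Ioi 0) (homQuasideviationMean f) lam ≠ 0 := by
      -- a sequence with finite weighted sum gives a positive lower bound for all constants
      let z : ℕ → ℝ := fun n => (1 / 2) ^ n / (1 + lam n)
      have hz : ∀ n, 0 < z n := fun n => div_pos (by positivity) (by linarith [hl n])
      have hzle : ∀ n, lam n * z n ≤ (1 / 2) ^ n := fun n => by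
        have := hl n
        have h2 : (0 : ℝ) < (1 / 2) ^ n := by positivity
        simp only [z]
        rw [← mul_div_assoc, div_le_iff₀ (by linarith)]
        nlinarith
      have hT : ∑' n : ℕ, ENNReal.ofReal (lam n * z n) ≠ ⊤ := by
        have hsum : Summable fun n => lam n * z n :=
          Summable.of_nonneg_of_le (fun n => mul_nonneg (hl n) (hz n).le) hzle
            (summable_geometric_of_lt_one (by norm_num) (by norm_num))
        exact hsum.tsum_ofReal_ne_top
      set A := ENNReal.ofReal (lam 0 * homQuasideviationMean f (0 + 1)
        (fun i : Fin (0 + 1) => z i) (fun i : Fin (0 + 1) => lam i)) with hA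
      have hA0 : 0 < A := by
        refine ENNReal.ofReal_pos.2 (mul_pos hl0 ?_)
        exact (homQuasideviationMean_spec hf hs (fun i => hz i)
          ⟨fun i => hl i, by simpa using hl0⟩).1
      have hle : A / ∑' n : ℕ, ENNReal.ofReal (lam n * z n) ≤
          hardyConstant (Ioi 0) (homQuasideviationMean f) lam := by
        refine le_sInf fun C hC => ?_
        refine ENNReal.div_le_of_le_mul (le_trans ?_ (hC z hz))
        exact ENNReal.le_tsum (f := fun n : ℕ => ENNReal.ofReal (lam n * homQuasideviationMean f
          (n + 1) (fun i : Fin (n + 1) => z i) (fun i : Fin (n + 1) => lam i))) 0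
      exact ((ENNReal.div_pos hA0.ne' hT).trans_le hle).ne'
    rw [hS, ENNReal.mul_top hK]
    exact le_top
  · rw [← ENNReal.div_le_iff hS0 hS]
    exact le_sInf fun C hC => (ENNReal.div_le_iff hS0 hS).2 (hC x hx)

end WellDefined

/-!
Write `E_n(x)` for the mean of the first `n + 1` terms of `x` (`prefixMean`), `Λ` for the partial
sums of the weights and `φ u = f (1 / u)`, an antitone function that changes sign at `1`.

*Reduction to one sequence.* Since `f` is concave and `λ_n / Λ_n` is nonincreasing, Kedlaya's
mixed-mean inequality `∑_{n ≤ N} λ_n E_n(x) ≤ Λ_N E_N(A)` holds, where `A` is the sequence of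
arithmetic means of `x` (`kedlaya`). As `A_n ≤ S / Λ_n` with `S = ∑_{n ≤ N} λ_n x_n`, a bound
`Λ_N E_N(1 / Λ) ≤ c` for all `N` makes `c` a Hardy constant (`isHardyBound_of_sum_nonpos`).
Conversely, testing the inequality on truncations of `1 / Λ` shows that every Hardy constant is at
least each `d` with `d ≤ Λ_n E_n(1 / Λ)` for all large `n`, because `∑ λ_n / Λ_n` diverges
(`le_of_isHardyBound`).

*Riemann sums.* The inequality `Λ_n E_n(1 / Λ) ≤ c` says that the right-endpoint Riemann sum of
`φ` over the partition of `(0, c]` by the points `c Λ_i / Λ_n` is nonpositive. All steps `[s, t]`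
of this partition satisfy `s ≤ (1 - η) t`. A function `R` with `R t ≥ t φ t` and with
`R t - R s ≥ (t - s) φ t` for such steps bounds the Riemann sum by `R c` (`sum_le_of_step_le`).
For `η = 0` such a potential is `R t = ∫₀ᵗ φ`. For `η > 0` it is the Riemann sum
`R t = η ∑ t (1 - η)^k φ (t (1 - η)^k)` of the geometric partition (`geometricPotential`), which
is concave because `u ↦ u f (1 / u)` is; the step inequality then compares slopes of `R` on
`[s, (1 - η) t]` and `[(1 - η) t, t]` (`step_le_geometricPotential`). In both cases `R` is
concave, positive on `(0, 1]` and decreasing somewhere, so it has exactly one zero `c`, and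
`R d > 0` for `d < c`.

*Lower bound.* If `R d > 0`, then the Riemann sums for `d` are eventually nonnegative. Discarding
nonnegative terms near `0` leaves an integral over a compact interval for `η = 0`
(`eventually_sum_nonneg_of_integral`) and a finite sum, to which the last terms converge, for
`η > 0` (`eventually_sum_nonneg_of_partialSum`). If `φ` is not integrable near `0`, then the
truncated integrals and the partial sums are unbounded, the same argument applies to every `d`,
and the Hardy constant is infinite.
-/

/-! ### Weights -/

theorem weightSum_succ (lam : ℕ → ℝ) (n : ℕ) :
    weightSum lam (n + 1) = weightSum lam n + lam (n + 1) :=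
  Finset.sum_range_succ _ _

theorem weightSum_zero (lam : ℕ → ℝ) : weightSum lam 0 = lam 0 := by
  simp [weightSum]

theorem weightSum_mono {lam : ℕ → ℝ} (hlam : lam ∈ weightSequences) : Monotone (weightSum lam) :=
  monotone_nat_of_le_succ fun n => by
    rw [weightSum_succ]
    linarith [hlam.2 (n + 1)]

theorem weightSum_pos {lam : ℕ → ℝ} (hlam : lam ∈ weightSequences) (n : ℕ) :
    0 < weightSum lam n :=
  calc 0 < lam 0 := hlam.1
    _ = weightSum lam 0 := (weightSum_zero lam).symm
    _ ≤ weightSum lam n := weightSum_mono hlam (Nat.zero_le n)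

/-- A vanishing weight would make all later ratios, hence all later weights, vanish, and the partial
sums would stay bounded. -/
theorem weight_pos {lam : ℕ → ℝ} (hlam : lam ∈ weightSequences)
    (hdiv : Tendsto (weightSum lam) atTop atTop)
    (hanti : Antitone fun n => lam n / weightSum lam n) (n : ℕ) : 0 < lam n := by
  refine lt_of_le_of_ne (hlam.2 n) fun h0 => ?_
  have hz : ∀ m, n ≤ m → lam m = 0 := fun m hm => by
    have h1 : lam m / weightSum lam m ≤ lam n / weightSum lam n := hanti hm
    rw [← h0, zero_div, div_le_iff₀ (weightSum_pos hlam m), zero_mul] at h1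
    exact le_antisymm h1 (hlam.2 m)
  have hc : ∀ m, n ≤ m → weightSum lam m = weightSum lam n := fun m hm => by
    induction m, hm using Nat.le_induction with
    | base => rfl
    | succ m hm ih => rw [weightSum_succ, ih, hz (m + 1) (by omega), add_zero]
  obtain ⟨m, hm, hnm⟩ := ((hdiv.eventually_gt_atTop (weightSum lam n)).and
    (eventually_ge_atTop n)).exists
  exact hm.ne' (hc m hnm)

theorem mul_weightSum_le_mul_weightSum {lam : ℕ → ℝ} (hlam : lam ∈ weightSequences)
    (hanti : Antitone fun n => lam n / weightSum lam n) {m n : ℕ} (hmn : m ≤ n) :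
    lam (n + 1) * weightSum lam m ≤ lam (m + 1) * weightSum lam n := by
  have h : lam (n + 1) / weightSum lam (n + 1) ≤ lam (m + 1) / weightSum lam (m + 1) :=
    hanti (Nat.succ_le_succ hmn)
  rw [div_le_div_iff₀ (weightSum_pos hlam _) (weightSum_pos hlam _), weightSum_succ,
    weightSum_succ] at h
  linarith

theorem weightSum_le_mul_weightSum_succ {lam : ℕ → ℝ} (hlam : lam ∈ weightSequences)
    (hanti : Antitone fun n => lam n / weightSum lam n) {η : ℝ}
    (hlim : Tendsto (fun n => lam n / weightSum lam n) atTop (𝓝 η)) (n : ℕ) :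
    weightSum lam n ≤ (1 - η) * weightSum lam (n + 1) := by
  have h : η ≤ lam (n + 1) / weightSum lam (n + 1) := hanti.le_of_tendsto hlim (n + 1)
  rw [le_div_iff₀ (weightSum_pos hlam _)] at h
  have := weightSum_succ lam n
  linarith

/-- The theorem of Abel and Dini: a block of terms is at least `(Λ_{m+k} - Λ_m) / Λ_{m+k}`, which
tends to `1` as the block grows, so the tails do not tend to `0`. -/
theorem not_summable_div_weightSum {lam : ℕ → ℝ} (hlam : lam ∈ weightSequences)
    (hdiv : Tendsto (weightSum lam) atTop atTop) :
    ¬ Summable fun n => lam n / weightSum lam n := by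
  intro hs
  have hnn : ∀ n, 0 ≤ lam n / weightSum lam n := fun n =>
    div_nonneg (hlam.2 n) (weightSum_pos hlam n).le
  obtain ⟨m, hm⟩ := ((tendsto_sum_nat_add fun n => lam n / weightSum lam n).eventually_lt_const
    (show (0 : ℝ) < 1 / 2 by norm_num)).exists
  have hblock : ∀ k, weightSum lam (m + k) - weightSum lam m ≤
      (∑ i ∈ Finset.range (k + 1), lam (i + m) / weightSum lam (i + m)) *
        weightSum lam (m + k) := fun k => by
    rw [Finset.sum_mul]
    have h1 : weightSum lam (m + k) - weightSum lam m ≤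
        ∑ i ∈ Finset.range (k + 1), lam (i + m) := by
      induction k with
      | zero => simpa using hlam.2 m
      | succ k ih =>
        rw [Finset.sum_range_succ, ← add_assoc, weightSum_succ,
          show k + 1 + m = m + k + 1 by omega]
        linarith
    refine h1.trans (Finset.sum_le_sum fun i hi => ?_)
    rw [div_mul_eq_mul_div, le_div_iff₀ (weightSum_pos hlam _)]
    refine mul_le_mul_of_nonneg_left (weightSum_mono hlam ?_) (hlam.2 _)
    have := Finset.mem_range.1 hi
    omega
  obtain ⟨k, hk⟩ := ((tendsto_atTop.1 hdiv (2 * weightSum lam m)).and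
    (eventually_ge_atTop m)).exists
  obtain ⟨j, rfl⟩ := Nat.exists_eq_add_of_le hk.2
  have h2 : ∑ i ∈ Finset.range (j + 1), lam (i + m) / weightSum lam (i + m) < 1 / 2 :=
    (((summable_nat_add_iff m).2 hs).sum_le_tsum _ fun i _ => hnn _).trans_lt hm
  have h3 := hblock j
  have h4 := mul_lt_mul_of_pos_right h2 (weightSum_pos hlam (m + j))
  linarith [hk.1]

/-! ### Means of initial segments -/

/-- The weighted mean of the first `n + 1` terms of `x`. -/
noncomputable def prefixMean (f : ℝ → ℝ) (lam x : ℕ → ℝ) (n : ℕ) : ℝ :=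
  homQuasideviationMean f (n + 1) (fun i : Fin (n + 1) => x i) (fun i : Fin (n + 1) => lam i)

theorem prefixMean_congr (f : ℝ → ℝ) (lam : ℕ → ℝ) {x y : ℕ → ℝ} {n : ℕ}
    (h : ∀ i ≤ n, x i = y i) : prefixMean f lam x n = prefixMean f lam y n := by
  unfold prefixMean
  congr 1
  funext i
  exact h i (Nat.lt_succ_iff.1 i.2)

section PrefixMean

variable {f : ℝ → ℝ} {lam x : ℕ → ℝ}

theorem mem_weightVectors (hlam : lam ∈ weightSequences) (n : ℕ) :
    (fun i : Fin (n + 1) => lam i) ∈ weightVectors (n + 1) := by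
  refine ⟨fun i => hlam.2 i, ?_⟩
  rw [Fin.sum_univ_eq_sum_range lam (n + 1)]
  exact weightSum_pos hlam n

theorem prefixMean_pos (hf : ConcaveOn ℝ (Ioi 0) f)
    (hs : ∀ x, 0 < x → SignType.sign (f x) = SignType.sign (x - 1))
    (hlam : lam ∈ weightSequences) (hx : ∀ n, 0 < x n) (n : ℕ) : 0 < prefixMean f lam x n :=
  (homQuasideviationMean_spec hf hs (fun i => hx i) (mem_weightVectors hlam n)).1

theorem sum_prefixMean (hf : ConcaveOn ℝ (Ioi 0) f)
    (hs : ∀ x, 0 < x → SignType.sign (f x) = SignType.sign (x - 1))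
    (hlam : lam ∈ weightSequences) (hx : ∀ n, 0 < x n) (n : ℕ) :
    ∑ i ∈ Finset.range (n + 1), lam i * f (x i / prefixMean f lam x n) = 0 := by
  rw [← Fin.sum_univ_eq_sum_range (fun i => lam i * f (x i / prefixMean f lam x n))]
  exact (homQuasideviationMean_spec hf hs (fun i => hx i) (mem_weightVectors hlam n)).2

theorem eq_prefixMean (hf : ConcaveOn ℝ (Ioi 0) f)
    (hs : ∀ x, 0 < x → SignType.sign (f x) = SignType.sign (x - 1))
    (hlam : lam ∈ weightSequences) (hx : ∀ n, 0 < x n) {n : ℕ} {y : ℝ} (hy : 0 < y)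
    (h : ∑ i ∈ Finset.range (n + 1), lam i * f (x i / y) = 0) : y = prefixMean f lam x n := by
  rw [← Fin.sum_univ_eq_sum_range (fun i => lam i * f (x i / y))] at h
  exact (existsUnique_quasideviationMean hf hs (fun i : Fin (n + 1) => hx i)
    (mem_weightVectors hlam n)).unique ⟨hy, h⟩
    (homQuasideviationMean_spec hf hs (fun i => hx i) (mem_weightVectors hlam n))

theorem sum_le_sum_of_le (hf : ConcaveOn ℝ (Ioi 0) f)
    (hs : ∀ x, 0 < x → SignType.sign (f x) = SignType.sign (x - 1))
    (hlam : lam ∈ weightSequences) (hx : ∀ n, 0 < x n) (n : ℕ) {y z : ℝ} (hy : 0 < y)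
    (hyz : y ≤ z) :
    ∑ i ∈ Finset.range (n + 1), lam i * f (x i / z) ≤
      ∑ i ∈ Finset.range (n + 1), lam i * f (x i / y) :=
  Finset.sum_le_sum fun i _ => mul_le_mul_of_nonneg_left
    (concave_sign_mono hf hs (div_pos (hx i) (hy.trans_le hyz))
      (div_le_div_of_nonneg_left (hx i).le hy hyz)) (hlam.2 i)

theorem prefixMean_le (hf : ConcaveOn ℝ (Ioi 0) f)
    (hs : ∀ x, 0 < x → SignType.sign (f x) = SignType.sign (x - 1))
    (hlam : lam ∈ weightSequences) (hx : ∀ n, 0 < x n) {n : ℕ} {y : ℝ} (hy : 0 < y)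
    (h : ∑ i ∈ Finset.range (n + 1), lam i * f (x i / y) ≤ 0) : prefixMean f lam x n ≤ y := by
  by_contra! hlt
  have h1 := sum_le_sum_of_le hf hs hlam hx n hy hlt.le
  rw [sum_prefixMean hf hs hlam hx n] at h1
  exact hlt.ne (eq_prefixMean hf hs hlam hx hy (le_antisymm h h1))

theorem le_prefixMean (hf : ConcaveOn ℝ (Ioi 0) f)
    (hs : ∀ x, 0 < x → SignType.sign (f x) = SignType.sign (x - 1))
    (hlam : lam ∈ weightSequences) (hx : ∀ n, 0 < x n) {n : ℕ} {y : ℝ} (hy : 0 < y)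
    (h : 0 ≤ ∑ i ∈ Finset.range (n + 1), lam i * f (x i / y)) : y ≤ prefixMean f lam x n := by
  by_contra! hlt
  have h1 := sum_le_sum_of_le hf hs hlam hx n (prefixMean_pos hf hs hlam hx n) hlt.le
  rw [sum_prefixMean hf hs hlam hx n] at h1
  exact hlt.ne' (eq_prefixMean hf hs hlam hx hy (le_antisymm h1 h))

end PrefixMean

/-! ### The mixed-mean inequality -/

/-- Jensen's inequality for three points of `(0, ∞)`, with weights that are not normalized. -/
theorem concaveOn_three {f : ℝ → ℝ} (hf : ConcaveOn ℝ (Ioi 0) f) {p₁ p₂ p₃ a₁ a₂ a₃ P b : ℝ}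
    (hp₁ : 0 ≤ p₁) (hp₂ : 0 ≤ p₂) (hp₃ : 0 ≤ p₃) (ha₁ : 0 < a₁) (ha₂ : 0 < a₂) (ha₃ : 0 < a₃)
    (hP : 0 < P) (hsum : p₁ + p₂ + p₃ = P) (hb : p₁ * a₁ + p₂ * a₂ + p₃ * a₃ = P * b) :
    p₁ * f a₁ + p₂ * f a₂ + p₃ * f a₃ ≤ P * f b := by
  have h := hf.le_map_sum (t := Finset.univ) (w := ![p₁ / P, p₂ / P, p₃ / P])
    (p := ![a₁, a₂, a₃])
    (by intro i _; fin_cases i <;> simp <;> positivity)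
    (by
      simp only [Fin.sum_univ_three, Matrix.cons_val]
      rw [← add_div, ← add_div, hsum, div_self hP.ne'])
    (by intro i _; fin_cases i <;> simpa)
  simp only [Fin.sum_univ_three, Matrix.cons_val, smul_eq_mul] at h
  have hb' : p₁ / P * a₁ + p₂ / P * a₂ + p₃ / P * a₃ = b := by
    field_simp
    linarith
  rw [hb'] at h
  calc p₁ * f a₁ + p₂ * f a₂ + p₃ * f a₃
      = P * (p₁ / P * f a₁ + p₂ / P * f a₂ + p₃ / P * f a₃) := by field_simp
    _ ≤ P * f b := mul_le_mul_of_nonneg_left h hP.le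

/-- The weighted arithmetic mean of the first `n + 1` terms of `x`. -/
noncomputable def prefixAverage (lam x : ℕ → ℝ) (n : ℕ) : ℝ :=
  (∑ i ∈ Finset.range (n + 1), lam i * x i) / weightSum lam n

section Kedlaya

variable {f : ℝ → ℝ} {lam x : ℕ → ℝ}

theorem weightSum_mul_prefixAverage (hlam : lam ∈ weightSequences) (n : ℕ) :
    weightSum lam n * prefixAverage lam x n = ∑ i ∈ Finset.range (n + 1), lam i * x i :=
  mul_div_cancel₀ _ (weightSum_pos hlam n).ne'

theorem prefixAverage_pos (hlam : lam ∈ weightSequences) (hx : ∀ n, 0 < x n) (n : ℕ) :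
    0 < prefixAverage lam x n := by
  refine div_pos (Finset.sum_pos' (fun i _ => mul_nonneg (hlam.2 i) (hx i).le)
    ⟨0, by simp, mul_pos hlam.1 (hx 0)⟩) (weightSum_pos hlam n)

/-- Let `α = Λ_N`, `β = λ_{N+1}` and `z = (α u + β v) / (α + β)`. Since
`Λ_{m+1} A_{m+1} = Λ_m A_m + λ_{m+1} x_{m+1}`, the point `A_{m+1} / z` is a convex combination of
`A_m / u`, `A_{m+1} / u` and `x_{m+1} / v`, and the weights are such that the contributions of the
points `A_m / u` from consecutive indices add up to a multiple of `λ_m f (A_m / u)`. The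
coefficient of the last one, `f (A_m / u)`, vanishes for `m = N + 1`. -/
theorem kedlaya_aux (hf : ConcaveOn ℝ (Ioi 0) f) (hlam : lam ∈ weightSequences)
    (hpos : ∀ n, 0 < lam n) (hanti : Antitone fun n => lam n / weightSum lam n)
    (hx : ∀ n, 0 < x n) (N : ℕ) {u v z : ℝ} (hu : 0 < u) (hv : 0 < v) (hz : 0 < z)
    (hzuv : weightSum lam (N + 1) * z = weightSum lam N * u + lam (N + 1) * v) :
    ∀ m ≤ N + 1,
      u * (weightSum lam (N + 1) *
            (∑ n ∈ Finset.range m, lam n * f (prefixAverage lam x n / u)) +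
          (weightSum lam N * lam m - (weightSum lam m - lam m) * lam (N + 1)) *
            f (prefixAverage lam x m / u)) +
        lam (N + 1) * v * ∑ n ∈ Finset.range (m + 1), lam n * f (x n / v) ≤
      weightSum lam (N + 1) * z *
        ∑ n ∈ Finset.range (m + 1), lam n * f (prefixAverage lam x n / z) := by
  intro m
  have hA := prefixAverage_pos hlam hx
  have hL := weightSum_pos hlam
  have hN := weightSum_succ lam N
  induction m with
  | zero =>
    intro _
    have h0 : prefixAverage lam x 0 = x 0 := by
      simp [prefixAverage, weightSum, (hpos 0).ne']
    have h := concaveOn_three hf (p₁ := 0) (p₂ := weightSum lam N * lam 0 * u)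
      (p₃ := lam (N + 1) * lam 0 * v) (a₁ := 1) (a₂ := x 0 / u) (a₃ := x 0 / v)
      (P := weightSum lam (N + 1) * z * lam 0) (b := x 0 / z) le_rfl
      (mul_pos (mul_pos (hL N) (hpos 0)) hu).le (mul_pos (mul_pos (hpos _) (hpos 0)) hv).le
      one_pos (div_pos (hx 0) hu) (div_pos (hx 0) hv) (mul_pos (mul_pos (hL _) hz) (hpos 0))
      (by rw [hzuv]; ring) (by field_simp; rw [hN]; ring)
    simp only [zero_add, Finset.range_zero, Finset.sum_empty, Finset.range_one,
      Finset.sum_singleton, weightSum_zero, h0]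
    linarith
  | succ m ih =>
    intro hm
    have hmono := mul_weightSum_le_mul_weightSum hlam hanti (Nat.succ_le_succ_iff.1 hm)
    have hrec : weightSum lam (m + 1) * prefixAverage lam x (m + 1) =
        weightSum lam m * prefixAverage lam x m + lam (m + 1) * x (m + 1) := by
      rw [weightSum_mul_prefixAverage hlam, weightSum_mul_prefixAverage hlam,
        Finset.sum_range_succ]
    have hm1 := weightSum_succ lam m
    have h := concaveOn_three hf (p₁ := weightSum lam m * lam (N + 1) * u)
      (p₂ := (weightSum lam N * lam (m + 1) - weightSum lam m * lam (N + 1)) * u)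
      (p₃ := lam (N + 1) * v * lam (m + 1)) (a₁ := prefixAverage lam x m / u)
      (a₂ := prefixAverage lam x (m + 1) / u) (a₃ := x (m + 1) / v)
      (P := weightSum lam (N + 1) * z * lam (m + 1)) (b := prefixAverage lam x (m + 1) / z)
      (mul_pos (mul_pos (hL m) (hpos _)) hu).le (mul_nonneg (by linarith) hu.le)
      (mul_pos (mul_pos (hpos _) hv) (hpos _)).le (div_pos (hA m) hu) (div_pos (hA _) hu)
      (div_pos (hx _) hv) (mul_pos (mul_pos (hL _) hz) (hpos _))
      (by rw [hzuv]; ring)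
      (by
        field_simp
        rw [hN]
        rw [hm1] at hrec
        linear_combination (-lam (N + 1)) * hrec)
    have ih' := ih (by omega)
    rw [Finset.sum_range_succ _ (m + 1), Finset.sum_range_succ _ (m + 1),
      Finset.sum_range_succ (fun n => lam n * f (prefixAverage lam x n / u)) m]
    rw [show weightSum lam (m + 1) - lam (m + 1) = weightSum lam m by linarith]
    rw [hN] at ih' h ⊢
    linarith

/-- The inductive step of the mixed-mean inequality. -/
theorem kedlaya_step (hf : ConcaveOn ℝ (Ioi 0) f)
    (hs : ∀ x, 0 < x → SignType.sign (f x) = SignType.sign (x - 1))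
    (hlam : lam ∈ weightSequences) (hpos : ∀ n, 0 < lam n)
    (hanti : Antitone fun n => lam n / weightSum lam n) (hx : ∀ n, 0 < x n) (N : ℕ) :
    weightSum lam N * prefixMean f lam (prefixAverage lam x) N +
        lam (N + 1) * prefixMean f lam x (N + 1) ≤
      weightSum lam (N + 1) * prefixMean f lam (prefixAverage lam x) (N + 1) := by
  have hA := prefixAverage_pos hlam hx
  have hu := prefixMean_pos hf hs hlam hA N
  have hv := prefixMean_pos hf hs hlam hx (N + 1)
  have hu0 := sum_prefixMean hf hs hlam hA N
  have hv0 := sum_prefixMean hf hs hlam hx (N + 1)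
  set u := prefixMean f lam (prefixAverage lam x) N
  set v := prefixMean f lam x (N + 1)
  have hL := weightSum_pos hlam (N + 1)
  have hz : 0 < (weightSum lam N * u + lam (N + 1) * v) / weightSum lam (N + 1) :=
    div_pos (add_pos (mul_pos (weightSum_pos hlam N) hu) (mul_pos (hpos _) hv)) hL
  have hzuv : weightSum lam (N + 1) *
      ((weightSum lam N * u + lam (N + 1) * v) / weightSum lam (N + 1)) =
      weightSum lam N * u + lam (N + 1) * v := mul_div_cancel₀ _ hL.ne'
  have h := kedlaya_aux hf hlam hpos hanti hx N hu hv hz hzuv (N + 1) le_rfl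
  rw [hu0, hv0, weightSum_succ, add_sub_cancel_right, sub_self] at h
  simp only [mul_zero, zero_mul, add_zero] at h
  rw [← weightSum_succ] at h
  have h' := nonneg_of_mul_nonneg_right h (mul_pos hL hz)
  have := le_prefixMean hf hs hlam hA hz h'
  rwa [div_le_iff₀' hL] at this

/-- Kedlaya's mixed-mean inequality: the average of the means is at most the mean of the
averages. -/
theorem kedlaya (hf : ConcaveOn ℝ (Ioi 0) f)
    (hs : ∀ x, 0 < x → SignType.sign (f x) = SignType.sign (x - 1))
    (hlam : lam ∈ weightSequences) (hpos : ∀ n, 0 < lam n)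
    (hanti : Antitone fun n => lam n / weightSum lam n) (hx : ∀ n, 0 < x n) (N : ℕ) :
    ∑ n ∈ Finset.range (N + 1), lam n * prefixMean f lam x n ≤
      weightSum lam N * prefixMean f lam (prefixAverage lam x) N := by
  induction N with
  | zero =>
    have h : prefixMean f lam x 0 = prefixMean f lam (prefixAverage lam x) 0 :=
      prefixMean_congr f lam fun i hi => by
        obtain rfl : i = 0 := by omega
        simp [prefixAverage, weightSum, (hpos 0).ne']
    simp [weightSum_zero, h]
  | succ N ih =>
    rw [Finset.sum_range_succ]
    linarith [kedlaya_step hf hs hlam hpos hanti hx N]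

end Kedlaya

/-! ### Reduction to the sequence of reciprocals of the partial sums -/

section Reduction

variable {f : ℝ → ℝ} {lam : ℕ → ℝ}

/-- By the mixed-mean inequality, `∑_{n ≤ N} λ_n E_n(x) ≤ Λ_N E_N(A)`, where `A_n ≤ S / Λ_n` for
`S = ∑_{n ≤ N} λ_n x_n`. The hypothesis says that `E_N(1 / Λ) ≤ c / Λ_N`. -/
theorem isHardyBound_of_sum_nonpos (hf : ConcaveOn ℝ (Ioi 0) f)
    (hs : ∀ x, 0 < x → SignType.sign (f x) = SignType.sign (x - 1))
    (hlam : lam ∈ weightSequences) (hpos : ∀ n, 0 < lam n)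
    (hanti : Antitone fun n => lam n / weightSum lam n) {c : ℝ} (hc : 0 < c)
    (h : ∀ N, ∑ i ∈ Finset.range (N + 1),
      lam i * f (1 / (c / weightSum lam N * weightSum lam i)) ≤ 0) :
    IsHardyBound (Ioi 0) (homQuasideviationMean f) lam (ENNReal.ofReal c) := by
  intro x hx
  have hL := weightSum_pos hlam
  have hterm : ∀ n, 0 ≤ lam n * prefixMean f lam x n := fun n =>
    mul_nonneg (hlam.2 n) (prefixMean_pos hf hs hlam hx n).le
  have hxn : ∀ n, 0 ≤ lam n * x n := fun n => mul_nonneg (hlam.2 n) (hx n).le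
  have hfin : ∀ N, ∑ n ∈ Finset.range (N + 1), lam n * prefixMean f lam x n ≤
      c * ∑ n ∈ Finset.range (N + 1), lam n * x n := by
    intro N
    set S := ∑ n ∈ Finset.range (N + 1), lam n * x n with hS
    have hS0 : 0 < S := Finset.sum_pos (fun i _ => mul_pos (hpos i) (hx i)) (by simp)
    have hy : 0 < c * S / weightSum lam N := div_pos (mul_pos hc hS0) (hL N)
    refine (kedlaya hf hs hlam hpos hanti hx N).trans ?_
    rw [← le_div_iff₀' (hL N)]
    refine prefixMean_le hf hs hlam (prefixAverage_pos hlam hx) hy (le_trans ?_ (h N))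
    refine Finset.sum_le_sum fun i hi => mul_le_mul_of_nonneg_left ?_ (hlam.2 i)
    refine concave_sign_mono hf hs (div_pos (prefixAverage_pos hlam hx i) hy) ?_
    have hAi : prefixAverage lam x i ≤ S / weightSum lam i := by
      rw [prefixAverage]
      refine div_le_div_of_nonneg_right ?_ (hL i).le
      exact Finset.sum_le_sum_of_subset_of_nonneg
        (Finset.range_mono (Finset.mem_range.1 hi)) fun j _ _ => hxn j
    calc prefixAverage lam x i / (c * S / weightSum lam N)
        ≤ S / weightSum lam i / (c * S / weightSum lam N) :=
          div_le_div_of_nonneg_right hAi hy.le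
      _ = 1 / (c / weightSum lam N * weightSum lam i) := by
          have := (hL i).ne'
          have := (hL N).ne'
          field_simp
  refine ENNReal.tsum_le_of_sum_range_le fun N => ?_
  rcases N with _ | N
  · simp
  calc ∑ n ∈ Finset.range (N + 1), ENNReal.ofReal (lam n * prefixMean f lam x n)
      = ENNReal.ofReal (∑ n ∈ Finset.range (N + 1), lam n * prefixMean f lam x n) :=
        (ENNReal.ofReal_sum_of_nonneg fun n _ => hterm n).symm
    _ ≤ ENNReal.ofReal (c * ∑ n ∈ Finset.range (N + 1), lam n * x n) :=
        ENNReal.ofReal_le_ofReal (hfin N)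
    _ = ENNReal.ofReal c * ∑ n ∈ Finset.range (N + 1), ENNReal.ofReal (lam n * x n) := by
        rw [ENNReal.ofReal_mul hc.le, ENNReal.ofReal_sum_of_nonneg fun n _ => hxn n]
    _ ≤ ENNReal.ofReal c * ∑' n : ℕ, ENNReal.ofReal (lam n * x n) := by
        gcongr
        exact ENNReal.sum_le_tsum _

/-- Test sequences: `x_n = 1 / Λ_n` for `n < N`, continued by terms with `∑ λ_n x_n ≤ 2`. The
hypothesis says that `E_n(1 / Λ) ≥ d / Λ_n` for large `n`, and `∑ λ_n / Λ_n` diverges, so the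
constant `2` and the small indices do not matter as `N → ∞`. -/
theorem le_of_isHardyBound (hf : ConcaveOn ℝ (Ioi 0) f)
    (hs : ∀ x, 0 < x → SignType.sign (f x) = SignType.sign (x - 1))
    (hlam : lam ∈ weightSequences) (hdiv : Tendsto (weightSum lam) atTop atTop) {d : ℝ}
    (hd : 0 < d)
    (h : ∀ᶠ n in atTop, 0 ≤ ∑ i ∈ Finset.range (n + 1),
      lam i * f (1 / (d / weightSum lam n * weightSum lam i))) {C : ENNReal}
    (hC : IsHardyBound (Ioi 0) (homQuasideviationMean f) lam C) : ENNReal.ofReal d ≤ C := by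
  rcases eq_or_ne C ⊤ with rfl | hCtop
  · exact le_top
  have hL := weightSum_pos hlam
  have hr : ∀ n, 0 < 1 / weightSum lam n := fun n => one_div_pos.2 (hL n)
  obtain ⟨m, hm⟩ := eventually_atTop.1 h
  set T : ℕ → ℝ := fun N => ∑ n ∈ Finset.range N, lam n / weightSum lam n with hT
  have hnn : ∀ n, 0 ≤ lam n / weightSum lam n := fun n => div_nonneg (hlam.2 n) (hL n).le
  have hTtop : Tendsto T atTop atTop :=
    (not_summable_iff_tendsto_nat_atTop_of_nonneg hnn).1 (not_summable_div_weightSum hlam hdiv)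
  have hmean : ∀ n, m ≤ n →
      d / weightSum lam n ≤ prefixMean f lam (fun i => 1 / weightSum lam i) n :=
    fun n hn => by
      refine le_prefixMean hf hs hlam hr (div_pos hd (hL n)) ((hm n hn).trans_eq ?_)
      refine Finset.sum_congr rfl fun i _ => ?_
      rw [div_div, mul_comm (weightSum lam i)]
  have hmain : ∀ N, m ≤ N → d * (T N - T m) ≤ C.toReal * (T N + 2) := by
    intro N hmN
    let x : ℕ → ℝ := fun n => if n < N then 1 / weightSum lam n else (1 / 2) ^ n / (1 + lam n)
    have hx : ∀ n, 0 < x n := fun n => by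
      have := hlam.2 n
      simp only [x]
      split_ifs
      · exact hr n
      · positivity
    have hxle : ∀ n, lam n * x n ≤
        (if n < N then lam n / weightSum lam n else 0) + (1 / 2) ^ n := fun n => by
      have h1 := hlam.2 n
      have h2 : (0 : ℝ) < (1 / 2) ^ n := by positivity
      simp only [x]
      split_ifs
      · rw [mul_one_div]
        linarith
      · rw [← mul_div_assoc, div_le_iff₀ (by linarith)]
        nlinarith
    have hsum1 : HasSum (fun n => if n < N then lam n / weightSum lam n else 0) (T N) := by
      let g : ℕ → ℝ := fun n => if n < N then lam n / weightSum lam n else 0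
      have h1 : HasSum g (∑ n ∈ Finset.range N, g n) :=
        hasSum_sum_of_ne_finset_zero fun n hn => if_neg fun h => hn (Finset.mem_range.2 h)
      convert h1 using 1
      exact Finset.sum_congr rfl fun n hn => (if_pos (Finset.mem_range.1 hn)).symm
    have hsum2 := hsum1.add (hasSum_geometric_two)
    have hxs : Summable fun n => lam n * x n :=
      Summable.of_nonneg_of_le (fun n => mul_nonneg (hlam.2 n) (hx n).le) hxle hsum2.summable
    have hright : ∑' n : ℕ, ENNReal.ofReal (lam n * x n) ≤ ENNReal.ofReal (T N + 2) := by
      rw [← ENNReal.ofReal_tsum_of_nonneg (fun n => mul_nonneg (hlam.2 n) (hx n).le) hxs]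
      exact ENNReal.ofReal_le_ofReal ((hxs.tsum_le_tsum hxle hsum2.summable).trans_eq hsum2.tsum_eq)
    have hleft : ENNReal.ofReal (d * (T N - T m)) ≤
        ∑' n : ℕ, ENNReal.ofReal (lam n * prefixMean f lam x n) := by
      have hnonneg : ∀ n, 0 ≤ lam n * prefixMean f lam x n := fun n =>
        mul_nonneg (hlam.2 n) (prefixMean_pos hf hs hlam hx n).le
      refine le_trans ?_ (ENNReal.sum_le_tsum (Finset.Ico m N))
      rw [← ENNReal.ofReal_sum_of_nonneg fun n _ => hnonneg n]
      refine ENNReal.ofReal_le_ofReal ?_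
      rw [hT, ← Finset.sum_Ico_eq_sub _ hmN, Finset.mul_sum]
      refine Finset.sum_le_sum fun n hn => ?_
      obtain ⟨hn1, hn2⟩ := Finset.mem_Ico.1 hn
      rw [prefixMean_congr f lam (y := fun i => 1 / weightSum lam i)
        fun i hi => if_pos (hi.trans_lt hn2)]
      calc d * (lam n / weightSum lam n) = lam n * (d / weightSum lam n) := by ring
        _ ≤ _ := mul_le_mul_of_nonneg_left (hmean n hn1) (hlam.2 n)
    have h3 : ENNReal.ofReal (d * (T N - T m)) ≤ ENNReal.ofReal (C.toReal * (T N + 2)) := by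
      rw [ENNReal.ofReal_mul ENNReal.toReal_nonneg, ENNReal.ofReal_toReal hCtop]
      exact hleft.trans ((hC x hx).trans (mul_le_mul_right hright C))
    have hTN : 0 ≤ T N := Finset.sum_nonneg fun n _ => hnn n
    exact (ENNReal.ofReal_le_ofReal_iff
      (mul_nonneg ENNReal.toReal_nonneg (by linarith))).1 h3
  refine ENNReal.ofReal_le_of_le_toReal ?_
  by_contra! hlt
  obtain ⟨N, hN, hmN⟩ := ((hTtop.eventually_gt_atTop
    ((d * T m + 2 * C.toReal) / (d - C.toReal))).and (eventually_ge_atTop m)).exists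
  rw [div_lt_iff₀ (by linarith)] at hN
  linarith [hmain N hmN]

end Reduction

/-! ### Riemann sums along the partial sums of the weights -/

/-- If `R` dominates the right-endpoint rule for all steps `[s, t]` with `s ≤ q t`, including the
degenerate one from `0`, then it dominates the Riemann sum over a partition with such steps. -/
theorem sum_le_of_step_le {lam : ℕ → ℝ} (hlam : lam ∈ weightSequences) {φ R : ℝ → ℝ} {q : ℝ}
    (hq : ∀ n, weightSum lam n ≤ q * weightSum lam (n + 1))
    (h0 : ∀ t, 0 < t → t * φ t ≤ R t)
    (h1 : ∀ s t, 0 < s → s ≤ q * t → (t - s) * φ t ≤ R t - R s) {a : ℝ} (ha : 0 < a) (N : ℕ) :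
    a * ∑ i ∈ Finset.range (N + 1), lam i * φ (a * weightSum lam i) ≤
      R (a * weightSum lam N) := by
  have hL := weightSum_pos hlam
  induction N with
  | zero =>
    have := h0 _ (mul_pos ha (hL 0))
    rw [weightSum_zero] at this
    simpa [weightSum_zero, ← mul_assoc] using this
  | succ N ih =>
    have := h1 (a * weightSum lam N) (a * weightSum lam (N + 1)) (mul_pos ha (hL N))
      (by rw [mul_left_comm]; exact mul_le_mul_of_nonneg_left (hq N) ha.le)
    rw [Finset.sum_range_succ]
    have h2 := weightSum_succ lam N
    have h3 : a * weightSum lam (N + 1) - a * weightSum lam N = a * lam (N + 1) := by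
      rw [h2]; ring
    rw [h3] at this
    linarith

theorem intervalIntegrable_of_antitoneOn {φ : ℝ → ℝ} (hφ : AntitoneOn φ (Ioi 0)) {s t : ℝ}
    (hs : 0 < s) (ht : 0 < t) : IntervalIntegrable φ volume s t :=
  (hφ.mono fun _ hx => mem_Ioi.2 ((lt_min hs ht).trans_le hx.1)).intervalIntegrable

theorem mul_le_intervalIntegral {φ : ℝ → ℝ} (hφ : AntitoneOn φ (Ioi 0)) {s t : ℝ}
    (hs : 0 < s) (hst : s ≤ t) : (t - s) * φ t ≤ ∫ u in s..t, φ u := by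
  have h := intervalIntegral.integral_mono_on hst intervalIntegrable_const
    (intervalIntegrable_of_antitoneOn hφ hs (hs.trans_le hst)) (f := fun _ => φ t)
    fun x hx => hφ (hs.trans_le hx.1) (hs.trans_le hst) hx.2
  simpa using h

theorem intervalIntegral_le_mul {φ : ℝ → ℝ} (hφ : AntitoneOn φ (Ioi 0)) {s t : ℝ}
    (hs : 0 < s) (hst : s ≤ t) : ∫ u in s..t, φ u ≤ (t - s) * φ s := by
  have h := intervalIntegral.integral_mono_on hst
    (intervalIntegrable_of_antitoneOn hφ hs (hs.trans_le hst)) intervalIntegrable_const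
    (g := fun _ => φ s) fun x hx => hφ hs (hs.trans_le hx.1) hx.1
  simpa using h

section LowerRiemann

variable {lam : ℕ → ℝ} {φ : ℝ → ℝ}

/-- If `λ_n / Λ_n → 0`, then consecutive partial sums have ratio close to `1`, and a
right-endpoint sum for `d` is at least a positive multiple of an integral up to a slightly larger
`d'`, apart from finitely many terms, which are eventually nonnegative. -/
theorem eventually_sum_nonneg_of_integral (hlam : lam ∈ weightSequences)
    (hdiv : Tendsto (weightSum lam) atTop atTop)
    (hlim : Tendsto (fun n => lam n / weightSum lam n) atTop (𝓝 0))
    (hφ : AntitoneOn φ (Ioi 0)) (hφ1 : ∀ u, 0 < u → u ≤ 1 → 0 ≤ φ u) {d d' δ₀ : ℝ} (hd : 0 < d)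
    (hdd' : d < d') (hδ₀ : 0 < δ₀) (hint : ∀ δ, 0 < δ → δ < δ₀ → 0 ≤ ∫ u in δ..d', φ u) :
    ∀ᶠ n in atTop, 0 ≤ ∑ i ∈ Finset.range (n + 1),
      lam i * φ (d / weightSum lam n * weightSum lam i) := by
  have hL := weightSum_pos hlam
  have hd' : 0 < d' := hd.trans hdd'
  set ρ := d' / d with hρ
  have hρ1 : 1 < ρ := (one_lt_div hd).2 hdd'
  have hρ0 : 0 < ρ := one_pos.trans hρ1
  have hρd : ρ * d = d' := div_mul_cancel₀ _ hd.ne'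
  obtain ⟨m, hm⟩ := eventually_atTop.1 (hlim.eventually_lt_const
    (show (0 : ℝ) < 1 - 1 / ρ by rw [sub_pos, div_lt_one hρ0]; exact hρ1))
  have hstep : ∀ n, m ≤ n → weightSum lam (n + 1) ≤ ρ * weightSum lam n := fun n hn => by
    have h1 := hm (n + 1) (by omega)
    rw [div_lt_iff₀ (hL _)] at h1
    have h2 := weightSum_succ lam n
    have h3 : 1 / ρ * weightSum lam (n + 1) ≤ weightSum lam n := by linarith
    rwa [div_mul_eq_mul_div, one_mul, div_le_iff₀' hρ0] at h3
  have hind : ∀ a, 0 < a → ∀ n, m ≤ n →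
      ρ * a * ∑ i ∈ Finset.range (m + 1), lam i * φ (a * weightSum lam i) +
        ∫ u in (ρ * a * weightSum lam m)..(ρ * a * weightSum lam n), φ u ≤
      ρ * a * ∑ i ∈ Finset.range (n + 1), lam i * φ (a * weightSum lam i) := by
    intro a ha n hn
    have hρa : 0 < ρ * a := mul_pos hρ0 ha
    induction n, hn using Nat.le_induction with
    | base => simp
    | succ n hn ih =>
      have h1 := hstep n hn
      have h2 : ρ * a * weightSum lam n ≤ ρ * a * weightSum lam (n + 1) :=
        mul_le_mul_of_nonneg_left (weightSum_mono hlam n.le_succ) hρa.le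
      have h3 : a * weightSum lam (n + 1) ≤ ρ * a * weightSum lam n := by
        calc a * weightSum lam (n + 1) ≤ a * (ρ * weightSum lam n) :=
              mul_le_mul_of_nonneg_left h1 ha.le
          _ = ρ * a * weightSum lam n := by ring
      have h4 := intervalIntegral_le_mul hφ (mul_pos hρa (hL n)) h2
      have h5 : φ (ρ * a * weightSum lam n) ≤ φ (a * weightSum lam (n + 1)) :=
        hφ (mul_pos ha (hL _)) (mul_pos hρa (hL n)) h3
      have h6 : ρ * a * weightSum lam (n + 1) - ρ * a * weightSum lam n =
          ρ * a * lam (n + 1) := by rw [weightSum_succ]; ring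
      rw [h6] at h4
      have h7 := mul_le_mul_of_nonneg_left h5 (mul_nonneg hρa.le (hlam.2 (n + 1)))
      rw [← intervalIntegral.integral_add_adjacent_intervals
        (intervalIntegrable_of_antitoneOn hφ (mul_pos hρa (hL m)) (mul_pos hρa (hL n)))
        (intervalIntegrable_of_antitoneOn hφ (mul_pos hρa (hL n)) (mul_pos hρa (hL _))),
        Finset.sum_range_succ _ (n + 1)]
      linarith
  have hsmall : Tendsto (fun n => d' * weightSum lam m / weightSum lam n) atTop (𝓝 0) :=
    hdiv.const_div_atTop _
  filter_upwards [eventually_ge_atTop m, hsmall.eventually_lt_const hδ₀,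
    hsmall.eventually_lt_const one_pos] with n hn h1 h2
  have ha : 0 < d / weightSum lam n := div_pos hd (hL n)
  have hρa : ρ * (d / weightSum lam n) = d' / weightSum lam n := by
    rw [← mul_div_assoc, hρd]
  have h3 := hind _ ha n hn
  have h4 : ρ * (d / weightSum lam n) * weightSum lam n = d' := by
    rw [hρa, div_mul_cancel₀ _ (hL n).ne']
  have h5 : ρ * (d / weightSum lam n) * weightSum lam m =
      d' * weightSum lam m / weightSum lam n := by
    rw [hρa]; ring
  rw [h4, h5] at h3
  have h6 := hint _ (div_pos (mul_pos hd' (hL m)) (hL n)) h1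
  have h7 : 0 ≤ ∑ i ∈ Finset.range (m + 1), lam i * φ (d / weightSum lam n * weightSum lam i) := by
    refine Finset.sum_nonneg fun i hi => mul_nonneg (hlam.2 i)
      (hφ1 _ (mul_pos ha (hL i)) (le_trans ?_ h2.le))
    rw [← h5]
    refine mul_le_mul ?_ (weightSum_mono hlam (Nat.lt_succ_iff.1 (Finset.mem_range.1 hi)))
      (hL i).le (mul_pos hρ0 ha).le
    exact le_mul_of_one_le_left ha.le hρ1.le
  have h8 := mul_nonneg (mul_pos hρ0 ha).le h7
  exact nonneg_of_mul_nonneg_right (by linarith) (mul_pos hρ0 ha)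

theorem tendsto_weightSum_div_weightSum_add (hlam : lam ∈ weightSequences) {η : ℝ}
    (hlim : Tendsto (fun n => lam n / weightSum lam n) atTop (𝓝 η)) (k : ℕ) :
    Tendsto (fun n => weightSum lam n / weightSum lam (n + k)) atTop (𝓝 ((1 - η) ^ k)) := by
  have hL := weightSum_pos hlam
  induction k with
  | zero => simp [div_self (hL _).ne']
  | succ k ih =>
    have h1 : Tendsto (fun n => 1 - lam (n + k + 1) / weightSum lam (n + k + 1)) atTop
        (𝓝 (1 - η)) := by
      have := (hlim.comp (tendsto_add_atTop_nat (k + 1))).const_sub 1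
      simpa [Function.comp_def, add_assoc] using this
    rw [pow_succ]
    refine (ih.mul h1).congr fun n => ?_
    have h2 := weightSum_succ lam (n + k)
    have h3 := (hL (n + k)).ne'
    have h4 := (hL (n + k + 1)).ne'
    rw [← add_assoc]
    field_simp
    rw [h2]
    ring

/-- The last `K` terms of the sum converge to the first `K` terms of the series, and the remaining
terms are nonnegative. -/
theorem eventually_sum_nonneg_of_partialSum (hlam : lam ∈ weightSequences) {η : ℝ} (hη : 0 < η)
    (hη1 : η < 1) (hlim : Tendsto (fun n => lam n / weightSum lam n) atTop (𝓝 η))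
    (hφc : ContinuousOn φ (Ioi 0)) (hφ1 : ∀ u, 0 < u → u ≤ 1 → 0 ≤ φ u) {d : ℝ} (hd : 0 < d)
    {K : ℕ} (hK : d * (1 - η) ^ K < 1)
    (hsum : 0 < ∑ k ∈ Finset.range K, (1 - η) ^ k * φ (d * (1 - η) ^ k)) :
    ∀ᶠ n in atTop, 0 ≤ ∑ i ∈ Finset.range (n + 1),
      lam i * φ (d / weightSum lam n * weightSum lam i) := by
  have hL := weightSum_pos hlam
  have hq : 0 < 1 - η := by linarith
  have hlimit : Tendsto (fun m => ∑ j ∈ Finset.range K,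
      lam (m + 1 + j) / weightSum lam (m + K) *
        φ (d / weightSum lam (m + K) * weightSum lam (m + 1 + j))) atTop
      (𝓝 (∑ j ∈ Finset.range K, η * (1 - η) ^ (K - 1 - j) * φ (d * (1 - η) ^ (K - 1 - j)))) := by
    refine tendsto_finsetSum _ fun j hj => ?_
    have hj := Finset.mem_range.1 hj
    have h1 : Tendsto (fun m => weightSum lam (m + 1 + j) / weightSum lam (m + K)) atTop
        (𝓝 ((1 - η) ^ (K - 1 - j))) := by
      refine ((tendsto_weightSum_div_weightSum_add hlam hlim (K - 1 - j)).comp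
        (tendsto_add_atTop_nat (1 + j))).congr fun m => ?_
      rw [Function.comp_apply, show m + (1 + j) + (K - 1 - j) = m + K by omega, ← add_assoc]
    have h2 : Tendsto (fun m => lam (m + 1 + j) / weightSum lam (m + 1 + j)) atTop (𝓝 η) := by
      refine (hlim.comp (tendsto_add_atTop_nat (1 + j))).congr fun m => ?_
      rw [Function.comp_apply, ← add_assoc]
    refine Tendsto.mul ((h2.mul h1).congr fun m => ?_) ?_
    · rw [div_mul_div_cancel₀ (hL _).ne']
    · have h3 : ContinuousAt φ (d * (1 - η) ^ (K - 1 - j)) :=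
        hφc.continuousAt (Ioi_mem_nhds (by positivity))
      refine h3.tendsto.comp ((h1.const_mul d).congr fun m => ?_)
      ring
  have hpos : 0 < ∑ j ∈ Finset.range K,
      η * (1 - η) ^ (K - 1 - j) * φ (d * (1 - η) ^ (K - 1 - j)) := by
    rw [Finset.sum_range_reflect (fun k => η * (1 - η) ^ k * φ (d * (1 - η) ^ k)) K]
    simp_rw [mul_assoc]
    rw [← Finset.mul_sum]
    exact mul_pos hη hsum
  have hhead := ((tendsto_weightSum_div_weightSum_add hlam hlim K).const_mul
    d).eventually_lt_const hK
  rw [← map_add_atTop_eq_nat K, eventually_map]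
  filter_upwards [hlimit.eventually_const_lt hpos, hhead] with m h1 h2
  rw [show m + K + 1 = m + 1 + K by omega, Finset.sum_range_add]
  refine add_nonneg (Finset.sum_nonneg fun i hi => mul_nonneg (hlam.2 i) (hφ1 _ ?_ ?_)) ?_
  · exact mul_pos (div_pos hd (hL _)) (hL i)
  · refine le_trans ?_ h2.le
    rw [div_mul_eq_mul_div, mul_div_assoc]
    exact mul_le_mul_of_nonneg_left (div_le_div_of_nonneg_right
      (weightSum_mono hlam (Nat.lt_succ_iff.1 (Finset.mem_range.1 hi))) (hL _).le) hd.le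
  · refine le_of_mul_le_mul_left ?_ (one_div_pos.2 (hL (m + K)))
    rw [mul_zero, Finset.mul_sum]
    refine h1.le.trans_eq (Finset.sum_congr rfl fun j _ => ?_)
    ring

end LowerRiemann

/-! ### Zeros of concave functions -/

theorem pos_of_lt_zero_of_concaveOn {R : ℝ → ℝ} (hR : ConcaveOn ℝ (Ioi 0) R)
    (h1 : ∀ t, 0 < t → t ≤ 1 → 0 < R t) {c d : ℝ} (hRc : R c = 0) (hd : 0 < d) (hdc : d < c) :
    0 < R d := by
  rcases le_or_gt d 1 with hd1 | hd1
  · exact h1 d hd hd1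
  by_contra! hle
  have h := hR.slope_anti_adjacent (mem_Ioi.2 one_pos) (mem_Ioi.2 (hd.trans hdc)) hd1 hdc
  have h2 : 0 ≤ (R c - R d) / (c - d) := div_nonneg (by linarith) (by linarith)
  have h3 : (R d - R 1) / (d - 1) < 0 :=
    div_neg_of_neg_of_pos (by linarith [h1 1 one_pos le_rfl]) (by linarith)
  linarith

theorem eq_of_zero_of_concaveOn {R : ℝ → ℝ} (hR : ConcaveOn ℝ (Ioi 0) R)
    (h1 : ∀ t, 0 < t → t ≤ 1 → 0 < R t) {c d : ℝ} (hc : 0 < c) (hd : 0 < d) (hRc : R c = 0)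
    (hRd : R d = 0) : d = c := by
  rcases lt_trichotomy d c with h | h | h
  · exact ((pos_of_lt_zero_of_concaveOn hR h1 hRc hd h).ne' hRd).elim
  · exact h
  · exact ((pos_of_lt_zero_of_concaveOn hR h1 hRd hc h).ne' hRc).elim

theorem exists_zero_of_concaveOn {R : ℝ → ℝ} (hR : ConcaveOn ℝ (Ioi 0) R)
    (h1 : ∀ t, 0 < t → t ≤ 1 → 0 < R t) {s t : ℝ} (hs : 0 < s) (hst : s < t)
    (hlt : R t < R s) : ∃ c, 0 < c ∧ R c = 0 := by
  have hm : 0 < (R s - R t) / (t - s) := div_pos (by linarith) (by linarith)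
  set m := (R s - R t) / (t - s) with hmdef
  have hq : 0 ≤ |R t| / m := by positivity
  -- the secant through `s` and `t` is negative at `z`
  set z := t + 1 + |R t| / m with hz
  have hz0 : 0 < z := by linarith
  have hRz : R z < 0 := by
    have h := hR.slope_anti_adjacent (mem_Ioi.2 hs) (mem_Ioi.2 hz0) hst (by linarith : t < z)
    have h2 : (R t - R s) / (t - s) = -m := by rw [hmdef, ← neg_div]; congr 1; ring
    rw [h2, div_le_iff₀ (by linarith)] at h
    have h3 : m * (z - t) = m + |R t| := by rw [hz]; field_simp; ring
    linarith [le_abs_self (R t)]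
  have hz1 : 1 ≤ z := by
    by_contra! h
    exact (h1 z hz0 h.le).not_gt hRz
  obtain ⟨c, hc, hc0⟩ := intermediate_value_Icc' hz1
    ((hR.continuousOn isOpen_Ioi).mono fun x hx => mem_Ioi.2 (one_pos.trans_le hx.1))
    ⟨hRz.le, (h1 1 one_pos le_rfl).le⟩
  exact ⟨c, one_pos.trans_le hc.1, hc0⟩

/-! ### The potential for `η = 0` -/

section IntegralPotential

variable {φ : ℝ → ℝ}

theorem intervalIntegrable_zero (hφ : AntitoneOn φ (Ioi 0)) (hint : IntegrableOn φ (Ioc 0 1))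
    {t : ℝ} (ht : 0 < t) : IntervalIntegrable φ volume 0 t :=
  ((intervalIntegrable_iff_integrableOn_Ioc_of_le zero_le_one).2 hint).trans
    (intervalIntegrable_of_antitoneOn hφ one_pos ht)

theorem integral_sub_integral (hφ : AntitoneOn φ (Ioi 0)) (hint : IntegrableOn φ (Ioc 0 1))
    {s t : ℝ} (hs : 0 < s) (ht : 0 < t) :
    (∫ u in (0 : ℝ)..t, φ u) - ∫ u in (0 : ℝ)..s, φ u = ∫ u in s..t, φ u :=
  intervalIntegral.integral_interval_sub_left (intervalIntegrable_zero hφ hint ht)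
    (intervalIntegrable_zero hφ hint hs)

theorem mul_le_integral_zero (hφ : AntitoneOn φ (Ioi 0)) (hint : IntegrableOn φ (Ioc 0 1))
    {t : ℝ} (ht : 0 < t) : t * φ t ≤ ∫ u in (0 : ℝ)..t, φ u := by
  have h := intervalIntegral.integral_mono_on_of_le_Ioo ht.le (f := fun _ => φ t)
    intervalIntegrable_const (intervalIntegrable_zero hφ hint ht)
    fun x hx => hφ (mem_Ioi.2 hx.1) (mem_Ioi.2 ht) hx.2.le
  simpa using h

theorem concaveOn_integral (hφ : AntitoneOn φ (Ioi 0)) (hint : IntegrableOn φ (Ioc 0 1)) :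
    ConcaveOn ℝ (Ioi 0) fun t => ∫ u in (0 : ℝ)..t, φ u := by
  refine concaveOn_of_slope_anti_adjacent (convex_Ioi 0) fun {x y z} hx hz hxy hyz => ?_
  have hy : 0 < y := lt_trans hx hxy
  rw [integral_sub_integral hφ hint hy hz, integral_sub_integral hφ hint hx hy]
  calc (∫ u in y..z, φ u) / (z - y) ≤ φ y := by
        rw [div_le_iff₀' (by linarith)]
        exact intervalIntegral_le_mul hφ hy hyz.le
    _ ≤ (∫ u in x..y, φ u) / (y - x) := by
        rw [le_div_iff₀' (by linarith)]
        exact mul_le_intervalIntegral hφ hx hxy.le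

theorem integral_zero_pos (hφ : AntitoneOn φ (Ioi 0)) (hint : IntegrableOn φ (Ioc 0 1))
    (hφ1 : ∀ u, 0 < u → u ≤ 1 → 0 ≤ φ u) (hφ1' : ∀ u, 0 < u → u < 1 → 0 < φ u) {t : ℝ}
    (ht : 0 < t) (ht1 : t ≤ 1) : 0 < ∫ u in (0 : ℝ)..t, φ u := by
  have h1 := mul_le_integral_zero hφ hint (half_pos ht)
  have h2 := mul_le_intervalIntegral hφ (half_pos ht) (by linarith : t / 2 ≤ t)
  rw [← integral_sub_integral hφ hint (half_pos ht) ht] at h2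
  have h3 := mul_pos (half_pos ht) (hφ1' (t / 2) (half_pos ht) (by linarith))
  have h4 := mul_nonneg (by linarith : 0 ≤ t - t / 2) (hφ1 t ht ht1)
  linarith

theorem integrableOn_of_integral_le (hφ : AntitoneOn φ (Ioi 0))
    (hφ1 : ∀ u, 0 < u → u ≤ 1 → 0 ≤ φ u) {a : ℕ → ℝ} (ha : ∀ n, 0 < a n)
    (ha0 : Tendsto a atTop (𝓝 0)) {B : ℝ} (hB : ∀ᶠ n in atTop, ∫ u in (a n)..1, φ u ≤ B) :
    IntegrableOn φ (Ioc 0 1) := by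
  refine integrableOn_Ioc_of_intervalIntegral_norm_bounded_left (l := atTop) (a := a) (I := B)
    (fun n => ?_) ha0 ?_
  · rcases le_total (a n) 1 with h | h
    · exact (intervalIntegrable_iff_integrableOn_Ioc_of_le h).1
        (intervalIntegrable_of_antitoneOn hφ (ha n) one_pos)
    · simp [Ioc_eq_empty_of_le h]
  · filter_upwards [hB, ha0.eventually_lt_const one_pos] with n hn h1
    rw [← intervalIntegral.integral_of_le h1.le]
    refine le_trans (le_of_eq (intervalIntegral.integral_congr fun u hu => ?_)) hn
    rw [uIcc_of_le h1.le] at hu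
    exact Real.norm_of_nonneg (hφ1 u ((ha n).trans_le hu.1) hu.2)

theorem exists_integral_nonneg_of_pos (hφ : AntitoneOn φ (Ioi 0))
    (hint : IntegrableOn φ (Ioc 0 1)) {d : ℝ} (hd : 0 < d)
    (hpos : 0 < ∫ u in (0 : ℝ)..d, φ u) :
    ∃ δ₀, 0 < δ₀ ∧ ∀ δ, 0 < δ → δ < δ₀ → 0 ≤ ∫ u in δ..d, φ u := by
  have hc : Tendsto (fun δ => ∫ u in (0 : ℝ)..δ, φ u) (𝓝[Icc 0 d] 0) (𝓝 0) := by
    have h := intervalIntegral.continuousOn_primitive_interval (μ := volume) (f := φ)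
      (a := 0) (b := d) (by
        rw [uIcc_of_le hd.le, integrableOn_Icc_iff_integrableOn_Ioc]
        exact (intervalIntegrable_iff_integrableOn_Ioc_of_le hd.le).1
          (intervalIntegrable_zero hφ hint hd))
    rw [uIcc_of_le hd.le] at h
    simpa [ContinuousWithinAt] using h 0 ⟨le_rfl, hd.le⟩
  have h1 := hc.eventually_lt_const hpos
  rw [eventually_nhdsWithin_iff, Metric.eventually_nhds_iff] at h1
  obtain ⟨ε, hε, h2⟩ := h1
  refine ⟨min ε d, lt_min hε hd, fun δ hδ hδ' => ?_⟩
  have h3 := h2 (y := δ) (by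
    rw [Real.dist_eq, sub_zero, abs_of_pos hδ]
    exact hδ'.trans_le (min_le_left _ _)) ⟨hδ.le, (hδ'.trans_le (min_le_right _ _)).le⟩
  rw [← integral_sub_integral hφ hint hδ hd]
  linarith

/-- The integrals over `[δ, d]` are unbounded as `δ → 0`, and they increase as `δ` decreases below `1`,
so they stay nonnegative once one of them is. -/
theorem exists_integral_nonneg_of_not_integrableOn (hφ : AntitoneOn φ (Ioi 0))
    (hφ1 : ∀ u, 0 < u → u ≤ 1 → 0 ≤ φ u) (hint : ¬ IntegrableOn φ (Ioc 0 1)) {d : ℝ}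
    (hd : 0 < d) : ∃ δ₀, 0 < δ₀ ∧ ∀ δ, 0 < δ → δ < δ₀ → 0 ≤ ∫ u in δ..d, φ u := by
  have hii : ∀ {s t : ℝ}, 0 < s → 0 < t → IntervalIntegrable φ volume s t := fun hs ht =>
    intervalIntegrable_of_antitoneOn hφ hs ht
  obtain ⟨n, hn⟩ : ∃ n : ℕ, -(∫ u in (1 : ℝ)..d, φ u) < ∫ u in (1 / ((n : ℝ) + 1))..1, φ u := by
    by_contra! h
    exact hint (integrableOn_of_integral_le hφ hφ1 (fun n => Nat.one_div_pos_of_nat)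
      tendsto_one_div_add_atTop_nhds_zero_nat (Eventually.of_forall h))
  have hδ₀ : (0 : ℝ) < 1 / ((n : ℝ) + 1) := Nat.one_div_pos_of_nat
  have hδ₁ : (1 : ℝ) / ((n : ℝ) + 1) ≤ 1 := by
    rw [div_le_one (by positivity)]
    linarith [n.cast_nonneg (α := ℝ)]
  refine ⟨_, hδ₀, fun δ hδ hδ' => ?_⟩
  have h1 : 0 ≤ ∫ u in δ..(1 / ((n : ℝ) + 1)), φ u :=
    intervalIntegral.integral_nonneg hδ'.le fun u hu =>
      hφ1 u (hδ.trans_le hu.1) (hu.2.trans hδ₁)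
  rw [← intervalIntegral.integral_add_adjacent_intervals (hii hδ hδ₀) (hii hδ₀ hd),
    ← intervalIntegral.integral_add_adjacent_intervals (hii hδ₀ one_pos) (hii one_pos hd)]
  linarith

end IntegralPotential

/-! ### The potential for `η > 0` -/

section GeometricPotential

variable {φ : ℝ → ℝ} {q : ℝ}

theorem integral_geometric_eq_sum (hφ : AntitoneOn φ (Ioi 0)) (hq : 0 < q) {t : ℝ} (ht : 0 < t)
    (K : ℕ) : ∫ u in (t * q ^ K)..t, φ u =
      ∑ k ∈ Finset.range K, ∫ u in (t * q ^ (k + 1))..(t * q ^ k), φ u := by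
  have hp : ∀ k, 0 < t * q ^ k := fun k => by positivity
  induction K with
  | zero => simp
  | succ K ih =>
    rw [Finset.sum_range_succ, ← ih, add_comm (∫ u in (t * q ^ K)..t, φ u),
      intervalIntegral.integral_add_adjacent_intervals
        (intervalIntegrable_of_antitoneOn hφ (hp _) (hp _))
        (intervalIntegrable_of_antitoneOn hφ (hp _) ht)]

theorem sum_geometric_le_integral (hφ : AntitoneOn φ (Ioi 0)) (hq : 0 < q) (hq1 : q < 1) {t : ℝ}
    (ht : 0 < t) (K : ℕ) :
    (1 - q) * ∑ k ∈ Finset.range K, t * q ^ k * φ (t * q ^ k) ≤ ∫ u in (t * q ^ K)..t, φ u := by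
  rw [integral_geometric_eq_sum hφ hq ht, Finset.mul_sum]
  refine Finset.sum_le_sum fun k _ => ?_
  have h := mul_le_intervalIntegral hφ (s := t * q ^ (k + 1)) (t := t * q ^ k) (by positivity)
    (mul_le_mul_of_nonneg_left (pow_le_pow_of_le_one hq.le hq1.le k.le_succ) ht.le)
  refine le_trans (le_of_eq ?_) h
  ring

theorem integral_le_sum_geometric (hφ : AntitoneOn φ (Ioi 0)) (hq : 0 < q) (hq1 : q < 1) {t : ℝ}
    (ht : 0 < t) (K : ℕ) :
    q * ∫ u in (t * q ^ K)..t, φ u ≤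
      (1 - q) * (∑ k ∈ Finset.range (K + 1), t * q ^ k * φ (t * q ^ k) - t * φ t) := by
  rw [Finset.sum_range_succ', pow_zero, mul_one, add_sub_cancel_right,
    integral_geometric_eq_sum hφ hq ht, Finset.mul_sum, Finset.mul_sum]
  refine Finset.sum_le_sum fun k _ => ?_
  have h := intervalIntegral_le_mul hφ (s := t * q ^ (k + 1)) (t := t * q ^ k) (by positivity)
    (mul_le_mul_of_nonneg_left (pow_le_pow_of_le_one hq.le hq1.le k.le_succ) ht.le)
  refine (mul_le_mul_of_nonneg_left h hq.le).trans (le_of_eq ?_)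
  ring

theorem tendsto_mul_pow_zero (hq : 0 < q) (hq1 : q < 1) (t : ℝ) :
    Tendsto (fun k : ℕ => t * q ^ k) atTop (𝓝 0) := by
  simpa using (tendsto_pow_atTop_nhds_zero_of_lt_one hq.le hq1).const_mul t

theorem summable_geometric_potential (hφ : AntitoneOn φ (Ioi 0))
    (hφ1 : ∀ u, 0 < u → u ≤ 1 → 0 ≤ φ u) (hint : IntegrableOn φ (Ioc 0 1)) (hq : 0 < q)
    (hq1 : q < 1) {t : ℝ} (ht : 0 < t) : Summable fun k : ℕ => t * q ^ k * φ (t * q ^ k) := by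
  -- shifting the index replaces `t` by some `t * q ^ m ≤ 1`, where the terms are nonnegative
  obtain ⟨m, hm⟩ := ((tendsto_mul_pow_zero hq hq1 t).eventually_lt_const one_pos).exists
  rw [← summable_nat_add_iff m]
  have hs : 0 < t * q ^ m := by positivity
  set s := t * q ^ m
  have hle : ∀ k : ℕ, s * q ^ k ≤ 1 := fun k =>
    (mul_le_of_le_one_right hs.le (pow_le_one₀ hq.le hq1.le)).trans hm.le
  have h : Summable fun k : ℕ => s * q ^ k * φ (s * q ^ k) := by
    refine summable_of_sum_range_le (c := (∫ u in (0 : ℝ)..s, φ u) / (1 - q))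
      (fun k => mul_nonneg (by positivity) (hφ1 _ (by positivity) (hle k))) fun K => ?_
    rw [le_div_iff₀' (by linarith)]
    refine (sum_geometric_le_integral hφ hq hq1 hs K).trans ?_
    have hK : 0 < s * q ^ K := by positivity
    rw [← integral_sub_integral hφ hint hK hs]
    have := (mul_nonneg hK.le (hφ1 _ hK (hle K))).trans (mul_le_integral_zero hφ hint hK)
    linarith
  refine h.congr fun k => ?_
  rw [show t * q ^ (k + m) = s * q ^ k by simp only [s]; ring]

theorem exists_partialSum_pos_of_not_integrableOn (hφ : AntitoneOn φ (Ioi 0))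
    (hφ1 : ∀ u, 0 < u → u ≤ 1 → 0 ≤ φ u) (hint : ¬ IntegrableOn φ (Ioc 0 1)) (hq : 0 < q)
    (hq1 : q < 1) {d : ℝ} (hd : 0 < d) :
    ∃ K : ℕ, d * q ^ K < 1 ∧ 0 < ∑ k ∈ Finset.range K, q ^ k * φ (d * q ^ k) := by
  by_contra! h
  obtain ⟨m, hm⟩ := eventually_atTop.1
    ((tendsto_mul_pow_zero hq hq1 d).eventually_lt_const one_pos)
  have hp : ∀ K : ℕ, 0 < d * q ^ K := fun K => by positivity
  refine hint (integrableOn_of_integral_le hφ hφ1 hp (tendsto_mul_pow_zero hq hq1 d)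
    (B := (1 - q) * (-(d * φ d)) / q + ∫ u in d..1, φ u) ?_)
  filter_upwards [eventually_ge_atTop m] with K hK
  have h1 := h (K + 1) (hm _ (by omega))
  have h2 := integral_le_sum_geometric hφ hq hq1 hd K
  have h3 : ∑ k ∈ Finset.range (K + 1), d * q ^ k * φ (d * q ^ k) ≤ 0 := by
    simp_rw [mul_assoc]
    rw [← Finset.mul_sum]
    exact mul_nonpos_of_nonneg_of_nonpos hd.le h1
  rw [← intervalIntegral.integral_add_adjacent_intervals
    (intervalIntegrable_of_antitoneOn hφ (hp K) hd)
    (intervalIntegrable_of_antitoneOn hφ hd one_pos)]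
  refine add_le_add_left ?_ _
  rw [le_div_iff₀' hq]
  refine h2.trans (mul_le_mul_of_nonneg_left ?_ (by linarith))
  linarith

theorem exists_partialSum_pos_of_tsum_pos (hq : 0 < q) (hq1 : q < 1) {d : ℝ} (hd : 0 < d)
    (hsum : Summable fun k : ℕ => d * q ^ k * φ (d * q ^ k))
    (hpos : 0 < ∑' k : ℕ, d * q ^ k * φ (d * q ^ k)) :
    ∃ K : ℕ, d * q ^ K < 1 ∧ 0 < ∑ k ∈ Finset.range K, q ^ k * φ (d * q ^ k) := by
  obtain ⟨K, hK, hK1⟩ := ((hsum.hasSum.tendsto_sum_nat.eventually_const_lt hpos).and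
    ((tendsto_mul_pow_zero hq hq1 d).eventually_lt_const one_pos)).exists
  refine ⟨K, hK1, ?_⟩
  simp_rw [mul_assoc] at hK
  rw [← Finset.mul_sum] at hK
  exact pos_of_mul_pos_right hK hd.le

/-- The sum `(1 - q) ∑ t q ^ k φ (t q ^ k)` of the areas of the rectangles of height `φ (t q ^ k)`
over the intervals `[t q ^ (k + 1), t q ^ k]`, which decompose `(0, t]`. -/
noncomputable def geometricPotential (q : ℝ) (φ : ℝ → ℝ) (t : ℝ) : ℝ :=
  (1 - q) * ∑' k : ℕ, t * q ^ k * φ (t * q ^ k)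

theorem geometricPotential_eq {t : ℝ} (hsum : Summable fun k : ℕ => t * q ^ k * φ (t * q ^ k)) :
    geometricPotential q φ t = (1 - q) * (t * φ t) + geometricPotential q φ (q * t) := by
  have h : ∀ k : ℕ, q * t * q ^ k = t * q ^ (k + 1) := fun k => by ring
  simp only [geometricPotential, h]
  rw [hsum.tsum_eq_zero_add]
  simp only [pow_zero, mul_one]
  ring

theorem concaveOn_geometricPotential (hφ : ConcaveOn ℝ (Ioi 0) fun u => u * φ u) (hq : 0 < q)
    (hq1 : q < 1) (hsum : ∀ t, 0 < t → Summable fun k : ℕ => t * q ^ k * φ (t * q ^ k)) :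
    ConcaveOn ℝ (Ioi 0) (geometricPotential q φ) := by
  refine ⟨convex_Ioi 0, fun x hx y hy a b ha hb hab => ?_⟩
  have hxy : 0 < a • x + b • y := convex_Ioi 0 hx hy ha hb hab
  have h := ((((hsum x hx).mul_left a).add ((hsum y hy).mul_left b)).tsum_le_tsum
    (g := fun k => (a • x + b • y) * q ^ k * φ ((a • x + b • y) * q ^ k)) (fun k => ?_)
    (hsum _ hxy))
  · rw [((hsum x hx).mul_left a).tsum_add ((hsum y hy).mul_left b), tsum_mul_left,
      tsum_mul_left] at h
    have h2 := mul_le_mul_of_nonneg_left h (by linarith : 0 ≤ 1 - q)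
    simp only [geometricPotential]
    refine le_trans (le_of_eq ?_) h2
    simp only [smul_eq_mul]
    ring
  · have hk : 0 < q ^ k := by positivity
    have h3 := hφ.2 (mem_Ioi.2 (mul_pos hx hk)) (mem_Ioi.2 (mul_pos hy hk)) ha hb hab
    have h4 : a • (x * q ^ k) + b • (y * q ^ k) = (a • x + b • y) * q ^ k := by
      simp only [smul_eq_mul]; ring
    rw [h4] at h3
    exact h3

theorem mul_le_geometricPotential (hφ : AntitoneOn φ (Ioi 0)) (hq : 0 < q) (hq1 : q < 1) {t : ℝ}
    (ht : 0 < t) (hsum : Summable fun k : ℕ => t * q ^ k * φ (t * q ^ k)) :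
    t * φ t ≤ geometricPotential q φ t := by
  have hg := (hasSum_geometric_of_lt_one hq.le hq1).mul_left (t * φ t)
  have h : (t * φ t) * (1 - q)⁻¹ ≤ ∑' k : ℕ, t * q ^ k * φ (t * q ^ k) := by
    rw [← hg.tsum_eq]
    refine hg.summable.tsum_le_tsum (fun k => ?_) hsum
    have h2 : φ t ≤ φ (t * q ^ k) := hφ (mem_Ioi.2 (by positivity)) ht
      (mul_le_of_le_one_right ht.le (pow_le_one₀ hq.le hq1.le))
    have h3 := mul_le_mul_of_nonneg_left h2 (show 0 ≤ t * q ^ k by positivity)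
    linarith
  rw [geometricPotential]
  rwa [← div_eq_mul_inv, div_le_iff₀' (by linarith)] at h

/-- By concavity, the slope of the potential on `[s, q t]` is at least its slope on `[q t, t]`,
which is `φ t`. -/
theorem step_le_geometricPotential
    (hφc : ConcaveOn ℝ (Ioi 0) fun u => u * φ u) (hq : 0 < q) (hq1 : q < 1)
    (hsum : ∀ t, 0 < t → Summable fun k : ℕ => t * q ^ k * φ (t * q ^ k)) (s t : ℝ) (hs : 0 < s)
    (hst : s ≤ q * t) :
    (t - s) * φ t ≤ geometricPotential q φ t - geometricPotential q φ s := by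
  have hqt : 0 < q * t := hs.trans_le hst
  have ht : 0 < t := pos_of_mul_pos_right hqt hq.le
  have hqt' : q * t < t := mul_lt_of_lt_one_left ht hq1
  have hrec := geometricPotential_eq (hsum t ht)
  rcases hst.eq_or_lt with rfl | hst
  · rw [hrec]
    linarith
  · have h := (concaveOn_geometricPotential hφc hq hq1 hsum).slope_anti_adjacent
      (mem_Ioi.2 hs) (mem_Ioi.2 ht) hst hqt'
    have h2 : (geometricPotential q φ t - geometricPotential q φ (q * t)) / (t - q * t) = φ t := by
      rw [hrec, div_eq_iff (by linarith)]
      ring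
    rw [h2, le_div_iff₀ (by linarith)] at h
    linarith

theorem geometricPotential_pos (hφ1 : ∀ u, 0 < u → u ≤ 1 → 0 ≤ φ u)
    (hφ1' : ∀ u, 0 < u → u < 1 → 0 < φ u) (hq : 0 < q) (hq1 : q < 1) {t : ℝ} (ht : 0 < t)
    (ht1 : t ≤ 1) (hsum : Summable fun k : ℕ => t * q ^ k * φ (t * q ^ k)) :
    0 < geometricPotential q φ t := by
  refine mul_pos (by linarith) (hsum.tsum_pos (fun k => ?_) 1 ?_)
  · exact mul_nonneg (by positivity) (hφ1 _ (by positivity)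
      ((mul_le_of_le_one_right ht.le (pow_le_one₀ hq.le hq1.le)).trans ht1))
  · rw [pow_one]
    have : t * q < 1 := (mul_lt_of_lt_one_right ht hq1).trans_le ht1
    exact mul_pos (by positivity) (hφ1' _ (by positivity) this)

end GeometricPotential

/-! ### The Hardy constant -/

section HardyConstant

variable {f : ℝ → ℝ} {lam : ℕ → ℝ}

theorem antitoneOn_comp_one_div (hf : ConcaveOn ℝ (Ioi 0) f)
    (hs : ∀ x, 0 < x → SignType.sign (f x) = SignType.sign (x - 1)) :
    AntitoneOn (fun u => f (1 / u)) (Ioi 0) := fun _ hu _ hv huv =>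
  concave_sign_mono hf hs (one_div_pos.2 hv) (one_div_le_one_div_of_le hu huv)

theorem comp_one_div_pos (hs : ∀ x, 0 < x → SignType.sign (f x) = SignType.sign (x - 1)) (u : ℝ)
    (hu : 0 < u) (hu1 : u < 1) : 0 < f (1 / u) :=
  (sign_facts hs).2.2 _ ((one_lt_div hu).2 hu1)

theorem comp_one_div_nonneg (hs : ∀ x, 0 < x → SignType.sign (f x) = SignType.sign (x - 1))
    (u : ℝ) (hu : 0 < u) (hu1 : u ≤ 1) : 0 ≤ f (1 / u) := by
  rcases hu1.eq_or_lt with rfl | h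
  · rw [div_one, (sign_facts hs).1]
  · exact (comp_one_div_pos hs u hu h).le

theorem comp_one_div_neg (hs : ∀ x, 0 < x → SignType.sign (f x) = SignType.sign (x - 1)) {u : ℝ}
    (hu1 : 1 < u) : f (1 / u) < 0 := by
  have hu : 0 < u := one_pos.trans hu1
  exact (sign_facts hs).2.1 _ (one_div_pos.2 hu) ((div_lt_one hu).2 hu1)

theorem concaveOn_perspective (hf : ConcaveOn ℝ (Ioi 0) f) :
    ConcaveOn ℝ (Ioi 0) fun u => u * f (1 / u) := by
  refine ⟨convex_Ioi 0, fun x hx y hy a b ha hb hab => ?_⟩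
  have hx0 : 0 < x := hx
  have hy0 : 0 < y := hy
  have hxy : 0 < a • x + b • y := convex_Ioi 0 hx hy ha hb hab
  simp only [smul_eq_mul] at hxy ⊢
  have h := concaveOn_three hf (p₁ := a * x) (p₂ := b * y) (p₃ := 0) (a₁ := 1 / x) (a₂ := 1 / y)
    (a₃ := 1) (b := 1 / (a * x + b * y)) (mul_nonneg ha hx0.le) (mul_nonneg hb hy0.le) le_rfl
    (one_div_pos.2 hx0) (one_div_pos.2 hy0) one_pos hxy (add_zero _)
    (by rw [mul_one_div_cancel hxy.ne']; field_simp; linarith)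
  linarith

theorem hardyConstant_eq_ofReal (hf : ConcaveOn ℝ (Ioi 0) f)
    (hs : ∀ x, 0 < x → SignType.sign (f x) = SignType.sign (x - 1))
    (hlam : lam ∈ weightSequences) (hdiv : Tendsto (weightSum lam) atTop atTop) {c : ℝ}
    (hbound : IsHardyBound (Ioi 0) (homQuasideviationMean f) lam (ENNReal.ofReal c))
    (hlow : ∀ d, 0 < d → d < c → ∀ᶠ n in atTop, 0 ≤ ∑ i ∈ Finset.range (n + 1),
      lam i * f (1 / (d / weightSum lam n * weightSum lam i))) :
    hardyConstant (Ioi 0) (homQuasideviationMean f) lam = ENNReal.ofReal c := by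
  refine le_antisymm (sInf_le hbound) (le_sInf fun C hC => ?_)
  by_contra! hlt
  have hCc : C.toReal < c := (ENNReal.lt_ofReal_iff_toReal_lt hlt.ne_top).1 hlt
  have hC0 : 0 ≤ C.toReal := ENNReal.toReal_nonneg
  have h := le_of_isHardyBound hf hs hlam hdiv (by linarith : 0 < (C.toReal + c) / 2)
    (hlow _ (by linarith) (by linarith)) hC
  have h2 := ENNReal.ofReal_le_iff_le_toReal hlt.ne_top |>.1 h
  linarith

theorem hardyConstant_eq_top (hf : ConcaveOn ℝ (Ioi 0) f)
    (hs : ∀ x, 0 < x → SignType.sign (f x) = SignType.sign (x - 1))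
    (hlam : lam ∈ weightSequences) (hdiv : Tendsto (weightSum lam) atTop atTop)
    (hlow : ∀ d, 0 < d → ∀ᶠ n in atTop, 0 ≤ ∑ i ∈ Finset.range (n + 1),
      lam i * f (1 / (d / weightSum lam n * weightSum lam i))) :
    hardyConstant (Ioi 0) (homQuasideviationMean f) lam = ⊤ := by
  refine sInf_eq_top.2 fun C hC => ?_
  by_contra hne
  have hC0 : 0 ≤ C.toReal := ENNReal.toReal_nonneg
  have h := le_of_isHardyBound hf hs hlam hdiv (by linarith : 0 < C.toReal + 1)
    (hlow _ (by linarith)) hC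
  have h2 := ENNReal.ofReal_le_iff_le_toReal hne |>.1 h
  linarith

/-- A potential `R` determines the Hardy constant as its only zero. -/
theorem exists_hardyConstant_of_potential (hf : ConcaveOn ℝ (Ioi 0) f)
    (hs : ∀ x, 0 < x → SignType.sign (f x) = SignType.sign (x - 1))
    (hlam : lam ∈ weightSequences) (hdiv : Tendsto (weightSum lam) atTop atTop)
    (hanti : Antitone fun n => lam n / weightSum lam n) {R : ℝ → ℝ} {q : ℝ}
    (hq : ∀ n, weightSum lam n ≤ q * weightSum lam (n + 1))
    (hR : ConcaveOn ℝ (Ioi 0) R) (hR1 : ∀ t, 0 < t → t ≤ 1 → 0 < R t)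
    (h0 : ∀ t, 0 < t → t * f (1 / t) ≤ R t)
    (h1 : ∀ s t, 0 < s → s ≤ q * t → (t - s) * f (1 / t) ≤ R t - R s)
    {s t : ℝ} (hs0 : 0 < s) (hst : s < t) (hRst : R t < R s)
    (hlow : ∀ d, 0 < d → 0 < R d → ∀ᶠ n in atTop, 0 ≤ ∑ i ∈ Finset.range (n + 1),
      lam i * f (1 / (d / weightSum lam n * weightSum lam i))) :
    ∃ c, 0 < c ∧ R c = 0 ∧
      hardyConstant (Ioi 0) (homQuasideviationMean f) lam = ENNReal.ofReal c ∧
      ∀ c', 0 < c' → R c' = 0 → c' = c := by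
  obtain ⟨c, hc, hRc⟩ := exists_zero_of_concaveOn hR hR1 hs0 hst hRst
  refine ⟨c, hc, hRc, ?_, fun c' hc' hRc' => eq_of_zero_of_concaveOn hR hR1 hc hc' hRc hRc'⟩
  refine hardyConstant_eq_ofReal hf hs hlam hdiv ?_ fun d hd hdc =>
    hlow d hd (pos_of_lt_zero_of_concaveOn hR hR1 hRc hd hdc)
  refine isHardyBound_of_sum_nonpos hf hs hlam (weight_pos hlam hdiv hanti) hanti hc fun N => ?_
  have hL := weightSum_pos hlam N
  have ha : 0 < c / weightSum lam N := div_pos hc hL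
  have h := sum_le_of_step_le hlam (φ := fun u => f (1 / u)) hq h0 h1 ha N
  rw [div_mul_cancel₀ _ hL.ne', hRc] at h
  exact nonpos_of_mul_nonpos_right h ha

theorem solvesHardyEquation_zero_iff (hf : ConcaveOn ℝ (Ioi 0) f)
    (hs : ∀ x, 0 < x → SignType.sign (f x) = SignType.sign (x - 1))
    (hint : IntegrableOn (fun x => f (1 / x)) (Ioc 0 1) volume) {c : ℝ} :
    SolvesHardyEquation 0 f c ↔ 0 < c ∧ ∫ u in (0 : ℝ)..c, f (1 / u) = 0 := by
  have hφ := antitoneOn_comp_one_div hf hs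
  have hscale : 0 < c →
      ∫ x in Ioc (0 : ℝ) 1, f (1 / (c * x)) = c⁻¹ * ∫ u in (0 : ℝ)..c, f (1 / u) := fun hc => by
    rw [← intervalIntegral.integral_of_le zero_le_one,
      intervalIntegral.integral_comp_mul_left (fun u => f (1 / u)) hc.ne', mul_zero, mul_one,
      smul_eq_mul]
  constructor
  · rintro ⟨hc, h, -⟩
    have h2 := (h rfl).2
    rw [hscale hc] at h2
    exact ⟨hc, (mul_eq_zero.1 h2).resolve_left (inv_pos.2 hc).ne'⟩
  · rintro ⟨hc, h⟩
    refine ⟨hc, fun _ => ⟨?_, by rw [hscale hc, h, mul_zero]⟩, fun h => (h rfl).elim⟩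
    have h2 := (intervalIntegrable_zero hφ hint hc).comp_mul_left (c := c)
    rw [zero_div, div_self hc.ne'] at h2
    exact (intervalIntegrable_iff_integrableOn_Ioc_of_le zero_le_one).1 h2

theorem solvesHardyEquation_pos_iff {η : ℝ} (hη : 0 < η)
    (hsum : ∀ t, 0 < t → Summable fun k : ℕ => t * (1 - η) ^ k * f (1 / (t * (1 - η) ^ k)))
    {c : ℝ} : SolvesHardyEquation η f c ↔
      0 < c ∧ geometricPotential (1 - η) (fun u => f (1 / u)) c = 0 := by
  have hscale : geometricPotential (1 - η) (fun u => f (1 / u)) c =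
      η * (c * ∑' k : ℕ, (1 - η) ^ k * f (1 / (c * (1 - η) ^ k))) := by
    rw [geometricPotential, sub_sub_cancel]
    simp_rw [mul_assoc c, tsum_mul_left]
  constructor
  · rintro ⟨hc, -, h⟩
    refine ⟨hc, ?_⟩
    rw [hscale, (h hη.ne').tsum_eq, mul_zero, mul_zero]
  · rintro ⟨hc, h⟩
    refine ⟨hc, fun h => (hη.ne' h).elim, fun _ => ?_⟩
    rw [hscale] at h
    have h2 := (mul_eq_zero.1 ((mul_eq_zero.1 h).resolve_left hη.ne')).resolve_left hc.ne'
    rw [← h2]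
    have h3 := hsum c hc
    simp_rw [mul_assoc c] at h3
    exact ((summable_mul_left_iff hc.ne').1 h3).hasSum

/-- The case `η = 0`. -/
theorem hardyConstant_of_limit_zero (hf : ConcaveOn ℝ (Ioi 0) f)
    (hs : ∀ x, 0 < x → SignType.sign (f x) = SignType.sign (x - 1))
    (hlam : lam ∈ weightSequences) (hdiv : Tendsto (weightSum lam) atTop atTop)
    (hanti : Antitone fun n => lam n / weightSum lam n)
    (hlim : Tendsto (fun n => lam n / weightSum lam n) atTop (𝓝 0)) :
    (¬ IntegrableOn (fun x => f (1 / x)) (Ioc 0 1) volume →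
      hardyConstant (Ioi 0) (homQuasideviationMean f) lam = ⊤) ∧
    (IntegrableOn (fun x => f (1 / x)) (Ioc 0 1) volume →
      ∃ c : ℝ, hardyConstant (Ioi 0) (homQuasideviationMean f) lam = ENNReal.ofReal c ∧
        SolvesHardyEquation 0 f c ∧ ∀ c' : ℝ, SolvesHardyEquation 0 f c' → c' = c) := by
  have hφ := antitoneOn_comp_one_div hf hs
  have hφ1 := comp_one_div_nonneg hs
  refine ⟨fun hint => hardyConstant_eq_top hf hs hlam hdiv fun d hd => ?_, fun hint => ?_⟩
  · obtain ⟨δ₀, hδ₀, h⟩ := exists_integral_nonneg_of_not_integrableOn hφ hφ1 hint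
      (by linarith : 0 < d + 1)
    exact eventually_sum_nonneg_of_integral hlam hdiv hlim hφ hφ1 hd (by linarith) hδ₀ h
  have hR := concaveOn_integral hφ hint
  have hdecr : ∫ u in (0 : ℝ)..3, f (1 / u) < ∫ u in (0 : ℝ)..2, f (1 / u) := by
    have h1 := integral_sub_integral hφ hint (two_pos) (three_pos)
    have h2 := intervalIntegral_le_mul hφ (two_pos) (by norm_num : (2 : ℝ) ≤ 3)
    have h3 := comp_one_div_neg hs (one_lt_two (α := ℝ))
    linarith
  obtain ⟨c, hc, hRc, hconst, huniq⟩ := exists_hardyConstant_of_potential hf hs hlam hdiv hanti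
    (q := 1 - 0) (weightSum_le_mul_weightSum_succ hlam hanti hlim) hR
    (fun t => integral_zero_pos hφ hint hφ1 (comp_one_div_pos hs))
    (fun t => mul_le_integral_zero hφ hint)
    (fun s t hs0 hst => by
      rw [sub_zero, one_mul] at hst
      rw [integral_sub_integral hφ hint hs0 (hs0.trans_le hst)]
      exact mul_le_intervalIntegral hφ hs0 hst)
    two_pos (by norm_num) hdecr fun d hd hRd => by
      have hcont : ContinuousAt (fun t => ∫ u in (0 : ℝ)..t, f (1 / u)) d :=
        (hR.continuousOn isOpen_Ioi).continuousAt (Ioi_mem_nhds hd)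
      obtain ⟨d', hd', hdd'⟩ := ((hcont.eventually_const_lt hRd).filter_mono
        nhdsWithin_le_nhds |>.and (self_mem_nhdsWithin (s := Ioi d))).exists
      obtain ⟨δ₀, hδ₀, h⟩ := exists_integral_nonneg_of_pos hφ hint (hd.trans hdd') hd'
      exact eventually_sum_nonneg_of_integral hlam hdiv hlim hφ hφ1 hd hdd' hδ₀ h
  refine ⟨c, hconst, (solvesHardyEquation_zero_iff hf hs hint).2 ⟨hc, hRc⟩, fun c' hc' => ?_⟩
  obtain ⟨h1, h2⟩ := (solvesHardyEquation_zero_iff hf hs hint).1 hc'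
  exact huniq c' h1 h2

/-- The case `η > 0`. -/
theorem hardyConstant_of_limit_pos (hf : ConcaveOn ℝ (Ioi 0) f)
    (hs : ∀ x, 0 < x → SignType.sign (f x) = SignType.sign (x - 1))
    (hlam : lam ∈ weightSequences) (hdiv : Tendsto (weightSum lam) atTop atTop)
    (hanti : Antitone fun n => lam n / weightSum lam n) {η : ℝ} (hη : 0 < η) (hη1 : η < 1)
    (hlim : Tendsto (fun n => lam n / weightSum lam n) atTop (𝓝 η)) :
    (¬ IntegrableOn (fun x => f (1 / x)) (Ioc 0 1) volume →
      hardyConstant (Ioi 0) (homQuasideviationMean f) lam = ⊤) ∧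
    (IntegrableOn (fun x => f (1 / x)) (Ioc 0 1) volume →
      ∃ c : ℝ, hardyConstant (Ioi 0) (homQuasideviationMean f) lam = ENNReal.ofReal c ∧
        SolvesHardyEquation η f c ∧ ∀ c' : ℝ, SolvesHardyEquation η f c' → c' = c) := by
  have hφ := antitoneOn_comp_one_div hf hs
  have hφ1 := comp_one_div_nonneg hs
  have hφc : ContinuousOn (fun u => f (1 / u)) (Ioi 0) := continuousOn_comp_div hf one_pos
  have hpersp := concaveOn_perspective hf
  have hq : 0 < 1 - η := by linarith
  have hq1 : 1 - η < 1 := by linarith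
  refine ⟨fun hint => hardyConstant_eq_top hf hs hlam hdiv fun d hd => ?_, fun hint => ?_⟩
  · obtain ⟨K, hK, h⟩ := exists_partialSum_pos_of_not_integrableOn hφ hφ1 hint hq hq1 hd
    exact eventually_sum_nonneg_of_partialSum hlam hη hη1 hlim hφc hφ1 hd hK h
  have hsum : ∀ t, 0 < t →
      Summable fun k : ℕ => t * (1 - η) ^ k * f (1 / (t * (1 - η) ^ k)) := fun t ht =>
    summable_geometric_potential hφ hφ1 hint hq hq1 ht
  have hinv : 1 < 1 / (1 - η) := (one_lt_div hq).2 hq1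
  have hdecr : geometricPotential (1 - η) (fun u => f (1 / u)) (1 / (1 - η)) <
      geometricPotential (1 - η) (fun u => f (1 / u)) 1 := by
    rw [geometricPotential_eq (φ := fun u => f (1 / u)) (hsum _ (one_pos.trans hinv)),
      mul_one_div_cancel hq.ne']
    have := mul_neg_of_pos_of_neg (one_pos.trans hinv) (comp_one_div_neg hs hinv)
    have := mul_neg_of_pos_of_neg (by linarith : 0 < 1 - (1 - η)) this
    linarith
  obtain ⟨c, hc, hRc, hconst, huniq⟩ := exists_hardyConstant_of_potential hf hs hlam hdiv hanti
    (weightSum_le_mul_weightSum_succ hlam hanti hlim)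
    (concaveOn_geometricPotential (φ := fun u => f (1 / u)) hpersp hq hq1 hsum)
    (fun t ht ht1 => geometricPotential_pos hφ1 (comp_one_div_pos hs) hq hq1 ht ht1 (hsum t ht))
    (fun t ht => mul_le_geometricPotential hφ hq hq1 ht (hsum t ht))
    (step_le_geometricPotential (φ := fun u => f (1 / u)) hpersp hq hq1 hsum)
    one_pos hinv hdecr fun d hd hRd => by
      obtain ⟨K, hK, h⟩ := exists_partialSum_pos_of_tsum_pos
        (φ := fun u => f (1 / u)) hq hq1 hd (hsum d hd)
        (pos_of_mul_pos_right hRd (by linarith))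
      exact eventually_sum_nonneg_of_partialSum hlam hη hη1 hlim hφc hφ1 hd hK h
  refine ⟨c, hconst, (solvesHardyEquation_pos_iff hη hsum).2 ⟨hc, hRc⟩, fun c' hc' => ?_⟩
  obtain ⟨h1, h2⟩ := (solvesHardyEquation_pos_iff hη hsum).1 hc'
  exact huniq c' h1 h2

end HardyConstant

theorem mainTheorem2
    (lam : ℕ → ℝ) (hlam : lam ∈ weightSequences)
    (hdiv : Tendsto (weightSum lam) atTop atTop)
    (hanti : Antitone fun n => lam n / weightSum lam n)
    (η : ℝ) (hη : η ∈ Ico (0 : ℝ) 1)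
    (hlim : Tendsto (fun n => lam n / weightSum lam n) atTop (𝓝 η))
    (f : ℝ → ℝ) (hf : ConcaveOn ℝ (Ioi 0) f)
    (hsign : ∀ x : ℝ, 0 < x → SignType.sign (f x) = SignType.sign (x - 1)) :
    (IsHardyMean (Ioi 0) (homQuasideviationMean f) lam ↔
      IntegrableOn (fun x => f (1 / x)) (Ioc 0 1) volume) ∧
    (IntegrableOn (fun x => f (1 / x)) (Ioc 0 1) volume →
      ∃ c : ℝ, hardyConstant (Ioi 0) (homQuasideviationMean f) lam = ENNReal.ofReal c ∧
        SolvesHardyEquation η f c ∧ ∀ c' : ℝ, SolvesHardyEquation η f c' → c' = c) := by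
  have key : (¬ IntegrableOn (fun x => f (1 / x)) (Ioc 0 1) volume →
        hardyConstant (Ioi 0) (homQuasideviationMean f) lam = ⊤) ∧
      (IntegrableOn (fun x => f (1 / x)) (Ioc 0 1) volume →
        ∃ c : ℝ, hardyConstant (Ioi 0) (homQuasideviationMean f) lam = ENNReal.ofReal c ∧
          SolvesHardyEquation η f c ∧ ∀ c' : ℝ, SolvesHardyEquation η f c' → c' = c) := by
    rcases hη.1.eq_or_lt with rfl | hη0
    · exact hardyConstant_of_limit_zero hf hsign hlam hdiv hanti hlim
    · exact hardyConstant_of_limit_pos hf hsign hlam hdiv hanti hη0 hη.2 hlim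
  refine ⟨⟨fun h => ?_, fun h => ?_⟩, key.2⟩
  · by_contra hint
    exact h.ne (key.1 hint)
  · obtain ⟨c, hc, -⟩ := key.2 h
    rw [IsHardyMean, hc]
    exact ENNReal.ofReal_lt_top
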